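/- **Theorem A.** For a simply connected planar domain $\Omega\subset\mathbb C$ and a conformal homeomorphism $\varphi:\Omega\to\mathbb D$ onto the unit disc, consider the moments $\iint_{\mathbb D}|(\varphi^{-1})'|^{\beta}\,du\,dv$, $\beta\in\mathbb R$. Call $\Omega$ conformal $\alpha$-regular ($\alpha>2$) if this moment is finite for $\beta=\alpha$ and some conformal homeomorphism $\varphi:\Omega\to\mathbb D$; say that Brennan's conjecture holds on an interval $I$ if the moment is finite for every $\beta\in I$, every simply connected planar domain $\Omega$ and every conformal homeomorphism $\varphi:\Omega\to\mathbb D$. Let $$\mu_p(\Omega)=\inf\left\{\frac{\iint_\Omega|\nabla u|^p}{\iint_\Omega|u|^p}:\ u\in W^{1,p}(\Omega)\setminus\{0\},\ \iint_\Omega|u|^{p-2}u=0\right\}$$ be the (variational) first nontrivial Neumann eigenvalue of the $p$-Laplacian, and let $B_{r,q}(\mathbb D)\in[0,\infty]$ be the exact constant in $\inf_{c\in\mathbb R}\|f-c\|_{L^r(\mathbb D)}\le B\,\|\nabla f\|_{L^q(\mathbb D)}$, $f\in W^{1,q}(\mathbb D)$ (it is $+\infty$ if the inequality holds with no finite $B$).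 Let $\Omega$ be a conformal $\alpha$-regular domain for some $\alpha>2$, let $\varphi:\Omega\to\mathbb D$ be any conformal homeomorphism, let $\alpha_0\in[-2,0)$, and assume that Brennan's conjecture holds on $(\alpha_0,2/3)$. For $p\in(4/3,2)$ put $$M_p=\inf_{q\in[1,2p/(4-p))}\left\{\|(\varphi^{-1})'\|_{L^\alpha(\mathbb D)}^{2}\left(\iint_{\mathbb D}|(\varphi^{-1})'|^{\frac{(p-2)q}{p-q}}\,du\,dv\right)^{\frac{p-q}{q}}B^{p}_{\frac{\alpha p}{\alpha-2},q}(\mathbb D)\right\}\in[0,\infty].$$ Then for every $p\in(4/3,2)$: 1. $\displaystyle \frac1{\mu_p(\Omega)}\le M_p$ (with $1/0=\infty$); 2. $\mu>0$ and $1/\mu\le M_p$ for every nonzero eigenvalue $\mu\in\mathbb{R}$ of the weak Neumann problem: $\iint_\Omega|\nabla u|^{p-2}\nabla u\cdot\nabla v=\mu\iint_\Omega|u|^{p-2}uv$ for all $v\in W^{1,p}(\Omega)$, with some $u\in W^{1,p}(\Omega)\setminus\{0\}$; 3. if moreover $$p>\max\left\{\frac{|\alpha_0|+2}{|\alpha_0|+1},\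 2-\frac{2|\alpha_0|}{2+|\alpha_0|}\cdot\frac{\alpha-2}{\alpha}\right\},$$ then $M_p<\infty$, so that $\mu_p(\Omega)>0$. In particular, if the full Brennan conjecture holds ($\alpha_0=-2$), then $M_p<\infty$ for every $p\in(\max\{4/3,(\alpha+2)/\alpha\},2)$. -/

import Mathlib

open MeasureTheory Set
open scoped ENNReal ContDiff

noncomputable section

/-- The open unit disc of the plane, the plane `ℝ²` being identified with `ℂ`. -/
def unitDisc : Set ℂ := Metric.ball 0 1

/-- A simply connected planar domain: an open, (path) connected, simply connected set. -/
def IsSimplyConnectedDomain (Ω : Set ℂ) : Prop :=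
  IsOpen Ω ∧ IsSimplyConnected Ω

/-- `φ` is a conformal homeomorphism of `Ω` onto the unit disc. Only the values on `Ω` matter. -/
def IsConformalOntoDisc (Ω : Set ℂ) (φ : ℂ → ℂ) : Prop :=
  DifferentiableOn ℂ φ Ω ∧ BijOn φ Ω unitDisc

/-- The derivative `(φ⁻¹)'` of the inverse of `φ : Ω → 𝔻`. It is used on the unit disc only,
where `Function.invFunOn φ Ω` is the inverse of the bijection `φ : Ω → 𝔻`. -/
def derivInv (Ω : Set ℂ) (φ : ℂ → ℂ) : ℂ → ℂ :=
  deriv (Function.invFunOn φ Ω)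

/-- The integral `∫_𝔻 |(φ⁻¹)'|^β`, with value in `[0, ∞]`. -/
def discMoment (Ω : Set ℂ) (φ : ℂ → ℂ) (β : ℝ) : ℝ≥0∞ :=
  ∫⁻ w in unitDisc, ‖derivInv Ω φ w‖ₑ ^ β

/-- Brennan's conjecture (for the inverse maps) holds for the exponents in `I`: for every
conformal homeomorphism `φ` of a simply connected planar domain onto the disc,
`∫_𝔻 |(φ⁻¹)'|^β < ∞` for every `β ∈ I`. -/
def BrennanConjectureOn (I : Set ℝ) : Prop :=
  ∀ (Ω : Set ℂ) (φ : ℂ → ℂ), IsSimplyConnectedDomain Ω → IsConformalOntoDisc Ω φ →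
    ∀ β ∈ I, discMoment Ω φ β < ⊤

/-- Conformal `α`-regular domains, `α > 2`. -/
def IsConformalRegular (α : ℝ) (Ω : Set ℂ) : Prop :=
  2 < α ∧ IsSimplyConnectedDomain Ω ∧
    ∃ φ : ℂ → ℂ, IsConformalOntoDisc Ω φ ∧ discMoment Ω φ α < ⊤

/-- `g` is the weak gradient of `u` on `Ω` (the vector `(u_x, u_y)` is the complex number
`u_x + i u_y`). -/
def HasWeakGradient (Ω : Set ℂ) (u : ℂ → ℝ) (g : ℂ → ℂ) : Prop :=
  LocallyIntegrableOn u Ω ∧ LocallyIntegrableOn g Ω ∧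
    ∀ η : ℂ → ℝ, ContDiff ℝ ∞ η → HasCompactSupport η → tsupport η ⊆ Ω →
      ∀ v : ℂ, (∫ z in Ω, u z * fderiv ℝ η z v) = - ∫ z in Ω, inner ℝ (g z) v * η z

/-- `u` belongs to the Sobolev space `W^{1,p}(Ω)` and `g` is its weak gradient. -/
def MemW (Ω : Set ℂ) (p : ℝ) (u : ℂ → ℝ) (g : ℂ → ℂ) : Prop :=
  HasWeakGradient Ω u g ∧ MemLp u (ENNReal.ofReal p) (volume.restrict Ω) ∧
    MemLp g (ENNReal.ofReal p) (volume.restrict Ω)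

/-- The number `μ_p(Ω)`: the infimum of the Rayleigh quotients `∫ |∇u|^p / ∫ |u|^p` over the
nonzero `u ∈ W^{1,p}(Ω)` with `∫ |u|^{p-2} u = 0`. -/
def firstNeumannEigenvalue (Ω : Set ℂ) (p : ℝ) : ℝ≥0∞ :=
  sInf {m : ℝ≥0∞ | ∃ (u : ℂ → ℝ) (g : ℂ → ℂ), MemW Ω p u g ∧
    ¬ (u =ᵐ[volume.restrict Ω] 0) ∧ (∫ z in Ω, |u z| ^ (p - 2) * u z) = 0 ∧
    m = (∫⁻ z in Ω, ‖g z‖ₑ ^ p) / (∫⁻ z in Ω, ‖u z‖ₑ ^ p)}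

/-- `m` is an eigenvalue of the weak Neumann problem for the `p`-Laplace operator on `Ω`. -/
def IsNeumannEigenvalue (Ω : Set ℂ) (p m : ℝ) : Prop :=
  ∃ (u : ℂ → ℝ) (g : ℂ → ℂ), MemW Ω p u g ∧ ¬ (u =ᵐ[volume.restrict Ω] 0) ∧
    ∀ (v : ℂ → ℝ) (k : ℂ → ℂ), MemW Ω p v k →
      (∫ z in Ω, ‖g z‖ ^ (p - 2) * inner ℝ (g z) (k z)) =
        m * ∫ z in Ω, |u z| ^ (p - 2) * u z * v z

/-- The exact constant `B_{r,q}(Ω)` of the Poincaré–Sobolev inequality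
`inf_c ‖f - c‖_{L^r(Ω)} ≤ B ‖∇f‖_{L^q(Ω)}`, `f ∈ W^{1,q}(Ω)`; it is `∞` if the inequality fails
with every finite constant. -/
def poincareSobolevConst (Ω : Set ℂ) (r q : ℝ) : ℝ≥0∞ :=
  sInf {B : ℝ≥0∞ | ∀ (f : ℂ → ℝ) (g : ℂ → ℂ), MemW Ω q f g →
    (⨅ c : ℝ, eLpNorm (fun z => f z - c) (ENNReal.ofReal r) (volume.restrict Ω)) ≤
      B * eLpNorm g (ENNReal.ofReal q) (volume.restrict Ω)}

/-- The bound
`inf_{1 ≤ q < 2p/(4-p)} ‖(φ⁻¹)'‖²_{L^α(𝔻)} (∫_𝔻 |(φ⁻¹)'|^{(p-2)q/(p-q)})^{(p-q)/q}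
B^p_{αp/(α-2),q}(𝔻)`, with value in `[0, ∞]`. -/
def conformalBound (Ω : Set ℂ) (φ : ℂ → ℂ) (α p : ℝ) : ℝ≥0∞ :=
  ⨅ q ∈ Ico (1 : ℝ) (2 * p / (4 - p)),
    eLpNorm (derivInv Ω φ) (ENNReal.ofReal α) (volume.restrict unitDisc) ^ (2 : ℝ) *
      discMoment Ω φ ((p - 2) * q / (p - q)) ^ ((p - q) / q) *
      poincareSobolevConst unitDisc (α * p / (α - 2)) q ^ p

end

/-! # Neumann eigenvalues of the `p`-Laplacian in conformal regular domains -/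

/-! Everything is transplanted to the disc by `ψ = φ⁻¹`. If `∫ |u|^{p-2} u = 0`, convexity of
`|·|^p` gives `∫ |u|^p ≤ ∫ |u - c|^p` for every `c` (`lintegral_enorm_rpow_le_of_integral_eq_zero`).
After the change of variables, Hölder with exponents `α/2` and `α/(α-2)` splits off `‖ψ'‖_α²` and
leaves `‖u ∘ ψ - c‖_r^p` with `r = αp/(α-2)`. The infimum over `c` is bounded by `B_{r,q} ‖∇(u ∘
ψ)‖_q`. Since `|∇(u ∘ ψ)| = |ψ'| |∇u| ∘ ψ`, a second Hölder inequality, with exponent `p/q`,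
produces the moment of order `(p-2)q/(p-q)` and `‖∇u‖_p`. This needs the weak chain rule
`HasWeakGradient.comp`, and `HasWeakGradient.memLp` to see that `u ∘ ψ` lies in `W^{1,q}` of the
disc.

An eigenfunction for `m ≠ 0`, tested with `1`, has zero mean (`Ω` has finite area because `α > 2`);
tested with itself, it has Rayleigh quotient `m`. So `m` is at least the variational eigenvalue.

For finiteness, `α`-regularity does not depend on `φ`, because two choices differ by a disc
automorphism, whose derivative is bounded. A suitable `q` puts the moment in Brennan's range and
makes the embedding into `L^r` subcritical (`exists_exponent`). Then `B_{r,q} < ∞` follows from a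
Riesz potential estimate and Young's inequality, extended from smooth to weakly differentiable
functions by mollification and Fatou. -/

noncomputable section

/-! ### Biholomorphic maps and change of variables. -/

/-- `F : U → V` and `G : V → U` are mutually inverse holomorphic maps of open sets. -/
structure IsBiholomorphic (U V : Set ℂ) (F G : ℂ → ℂ) : Prop where
  isOpen_source : IsOpen U
  isOpen_target : IsOpen V
  differentiableOn : DifferentiableOn ℂ F U
  differentiableOn_inv : DifferentiableOn ℂ G V
  mapsTo : MapsTo F U V
  mapsTo_inv : MapsTo G V U
  leftInvOn : LeftInvOn G F U
  rightInvOn : RightInvOn G F V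

namespace IsBiholomorphic

variable {U V W : Set ℂ} {F G F' G' : ℂ → ℂ}

theorem symm (h : IsBiholomorphic U V F G) : IsBiholomorphic V U G F :=
  ⟨h.isOpen_target, h.isOpen_source, h.differentiableOn_inv, h.differentiableOn, h.mapsTo_inv,
    h.mapsTo, h.rightInvOn, h.leftInvOn⟩

theorem comp (h' : IsBiholomorphic V W F' G') (h : IsBiholomorphic U V F G) :
    IsBiholomorphic U W (F' ∘ F) (G ∘ G') where
  isOpen_source := h.isOpen_source
  isOpen_target := h'.isOpen_target
  differentiableOn := h'.differentiableOn.comp h.differentiableOn h.mapsTo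
  differentiableOn_inv := h.differentiableOn_inv.comp h'.differentiableOn_inv h'.mapsTo_inv
  mapsTo := h'.mapsTo.comp h.mapsTo
  mapsTo_inv := h.mapsTo_inv.comp h'.mapsTo_inv
  leftInvOn z hz := by simp [h'.leftInvOn (h.mapsTo hz), h.leftInvOn hz]
  rightInvOn z hz := by simp [h.rightInvOn (h'.mapsTo_inv hz), h'.rightInvOn hz]

theorem injOn (h : IsBiholomorphic U V F G) : InjOn F U := h.leftInvOn.injOn

theorem image_eq (h : IsBiholomorphic U V F G) : F '' U = V :=
  Subset.antisymm h.mapsTo.image_subset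
    fun w hw => ⟨G w, h.mapsTo_inv hw, h.rightInvOn hw⟩

theorem differentiableAt (h : IsBiholomorphic U V F G) {z : ℂ} (hz : z ∈ U) :
    DifferentiableAt ℂ F z :=
  h.differentiableOn.differentiableAt (h.isOpen_source.mem_nhds hz)

theorem deriv_inv_mul_deriv (h : IsBiholomorphic U V F G) {z : ℂ} (hz : z ∈ U) :
    deriv G (F z) * deriv F z = 1 := by
  have h1 := ((h.symm.differentiableAt (h.mapsTo hz)).hasDerivAt).comp z
    (h.differentiableAt hz).hasDerivAt
  have h2 : G ∘ F =ᶠ[nhds z] id := by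
    filter_upwards [h.isOpen_source.mem_nhds hz] with w hw using h.leftInvOn hw
  exact h1.unique ((hasDerivAt_id z).congr_of_eventuallyEq h2)

theorem deriv_ne_zero (h : IsBiholomorphic U V F G) {z : ℂ} (hz : z ∈ U) : deriv F z ≠ 0 :=
  right_ne_zero_of_mul (h.deriv_inv_mul_deriv hz ▸ one_ne_zero)

theorem contDiffAt (h : IsBiholomorphic U V F G) {z : ℂ} (hz : z ∈ U) : ContDiffAt ℂ ω F z :=
  (h.differentiableOn.analyticAt (h.isOpen_source.mem_nhds hz)).contDiffAt

theorem contDiffAt_deriv (h : IsBiholomorphic U V F G) {z : ℂ} (hz : z ∈ U) :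
    ContDiffAt ℂ ω (deriv F) z :=
  (h.differentiableOn.analyticAt (h.isOpen_source.mem_nhds hz)).deriv.contDiffAt

theorem continuousOn (h : IsBiholomorphic U V F G) : ContinuousOn F U :=
  h.differentiableOn.continuousOn

theorem continuousOn_deriv (h : IsBiholomorphic U V F G) : ContinuousOn (deriv F) U :=
  fun _ hz => (h.contDiffAt_deriv hz).continuousAt.continuousWithinAt

end IsBiholomorphic

theorem Complex.abs_det_restrictScalars_toSpanSingleton (a : ℂ) :
    |((ContinuousLinearMap.toSpanSingleton ℂ a).restrictScalars ℝ).det| = ‖a‖ ^ 2 := by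
  have : ((ContinuousLinearMap.toSpanSingleton ℂ a).restrictScalars ℝ).det = ‖a‖ ^ 2 := by
    rw [ContinuousLinearMap.det]
    have := LinearMap.det_restrictScalars (R := ℝ)
      (f := ((ContinuousLinearMap.toSpanSingleton ℂ a : ℂ →L[ℂ] ℂ) : ℂ →ₗ[ℂ] ℂ))
    simp only [ContinuousLinearMap.coe_restrictScalars] at this ⊢
    rw [this, LinearMap.det_ring]
    simp [Algebra.norm_complex_apply, Complex.normSq_eq_norm_sq]
  rw [this, abs_of_nonneg (sq_nonneg _)]

namespace IsBiholomorphic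

variable {U V : Set ℂ} {F G : ℂ → ℂ}

theorem hasFDerivWithinAt (h : IsBiholomorphic U V F G) {S : Set ℂ} (hS : S ⊆ U) :
    ∀ z ∈ S, HasFDerivWithinAt F
      ((ContinuousLinearMap.toSpanSingleton ℂ (deriv F z)).restrictScalars ℝ) S z :=
  fun _ hz => ((h.differentiableAt (hS hz)).hasDerivAt.hasFDerivAt.restrictScalars
    ℝ).hasFDerivWithinAt

theorem setLIntegral_image (h : IsBiholomorphic U V F G) {S : Set ℂ} (hS : MeasurableSet S)
    (hSU : S ⊆ U) (k : ℂ → ℝ≥0∞) :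
    ∫⁻ w in F '' S, k w = ∫⁻ z in S, ‖deriv F z‖ₑ ^ (2 : ℝ) * k (F z) := by
  rw [lintegral_image_eq_lintegral_abs_det_fderiv_mul volume hS (h.hasFDerivWithinAt hSU)
    (h.injOn.mono hSU)]
  refine lintegral_congr fun z => ?_
  rw [Complex.abs_det_restrictScalars_toSpanSingleton, ENNReal.ofReal_pow (norm_nonneg _),
    ofReal_norm]
  norm_num

theorem setLIntegral_eq (h : IsBiholomorphic U V F G) (k : ℂ → ℝ≥0∞) :
    ∫⁻ w in V, k w = ∫⁻ z in U, ‖deriv F z‖ₑ ^ (2 : ℝ) * k (F z) := by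
  rw [← h.setLIntegral_image h.isOpen_source.measurableSet Subset.rfl, h.image_eq]

theorem setIntegral_eq {E : Type*} [NormedAddCommGroup E] [NormedSpace ℝ E]
    (h : IsBiholomorphic U V F G) (k : ℂ → E) :
    ∫ w in V, k w = ∫ z in U, ‖deriv F z‖ ^ 2 • k (F z) := by
  rw [← h.image_eq, integral_image_eq_integral_abs_det_fderiv_smul volume
    h.isOpen_source.measurableSet (h.hasFDerivWithinAt Subset.rfl) h.injOn]
  simp_rw [Complex.abs_det_restrictScalars_toSpanSingleton]

theorem integrableOn_image_iff {E : Type*} [NormedAddCommGroup E] [NormedSpace ℝ E]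
    (h : IsBiholomorphic U V F G) {S : Set ℂ} (hS : MeasurableSet S)
    (hSU : S ⊆ U) (k : ℂ → E) :
    IntegrableOn k (F '' S) ↔ IntegrableOn (fun z => ‖deriv F z‖ ^ 2 • k (F z)) S := by
  rw [integrableOn_image_iff_integrableOn_abs_det_fderiv_smul volume hS
    (h.hasFDerivWithinAt hSU) (h.injOn.mono hSU)]
  simp_rw [Complex.abs_det_restrictScalars_toSpanSingleton]

end IsBiholomorphic

/-- An injective holomorphic map of a domain is biholomorphic onto its image. -/
theorem isBiholomorphic_of_bijOn {U V : Set ℂ} {F G : ℂ → ℂ} (hU : IsOpen U)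
    (hUc : IsPreconnected U) (hUn : U.Nontrivial) (hF : DifferentiableOn ℂ F U) (hb : BijOn F U V)
    (hG : InvOn G F U V) : IsBiholomorphic U V F G := by
  have hmaps : MapsTo G V U := by
    intro w hw
    obtain ⟨z, hz, rfl⟩ := hb.surjOn hw
    rwa [hG.1 hz]
  have han : AnalyticOnNhd ℂ F U := fun z hz => hF.analyticAt (hU.mem_nhds hz)
  have hopen : ∀ S ⊆ U, IsOpen S → IsOpen (F '' S) := by
    rcases han.is_constant_or_isOpen hUc with ⟨c, hc⟩ | h
    · obtain ⟨x, hx, y, hy, hxy⟩ := hUn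
      exact absurd (hb.injOn hx hy ((hc x hx).trans (hc y hy).symm)) hxy
    · exact h
  have hV : IsOpen V := hb.image_eq ▸ hopen U Subset.rfl hU
  have hGc : ∀ w ∈ V, ContinuousAt G w := by
    intro w hw
    rw [continuousAt_def]
    intro N hN
    obtain ⟨S, hSN, hSo, hwS⟩ := mem_nhds_iff.1 hN
    refine Filter.mem_of_superset ((hopen (S ∩ U) inter_subset_right (hSo.inter hU)).mem_nhds
      ⟨G w, ⟨hwS, hmaps hw⟩, hG.2 hw⟩) ?_
    rintro _ ⟨z, ⟨hzS, hzU⟩, rfl⟩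
    exact hSN (by rwa [hG.1 hzU])
  have hGd : ∀ w ∈ V, deriv F (G w) ≠ 0 → DifferentiableAt ℂ G w := by
    intro w hw hne
    refine (HasDerivAt.of_local_left_inverse (hGc w hw)
      (hF.differentiableAt (hU.mem_nhds (hmaps hw))).hasDerivAt hne ?_).differentiableAt
    filter_upwards [hV.mem_nhds hw] with v hv using hG.2 hv
  refine ⟨hU, hV, hF, fun w hw => ?_, hb.mapsTo, hmaps, hG.1, hG.2⟩
  refine DifferentiableAt.differentiableWithinAt ?_
  have hz := hmaps hw
  -- Either `F' = 0` near `G w`, so `F` is locally constant, against injectivity; or zeros of `F'`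
  -- are isolated, so `G` is holomorphic on a punctured neighbourhood of `w` and continuous at `w`,
  -- a removable singularity.
  rcases (han _ hz).deriv.eventually_eq_zero_or_eventually_ne_zero with h0 | h0
  · exfalso
    obtain ⟨ε, hε, hball⟩ := Metric.eventually_nhds_iff_ball.1 (h0.and (hU.mem_nhds hz))
    have hconst : ∀ x ∈ Metric.ball (G w) ε, F x = F (G w) := fun x hx =>
      (convex_ball (G w) ε).is_const_of_fderivWithin_eq_zero (𝕜 := ℂ)
        (fun y hy => (hF.differentiableAt (hU.mem_nhds (hball y hy).2)).differentiableWithinAt)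
        (fun y hy => by
          rw [fderivWithin_of_isOpen Metric.isOpen_ball hy]
          ext
          simpa using (hball y hy).1) hx (Metric.mem_ball_self hε)
    have hx : G w + (ε / 2 : ℝ) ∈ Metric.ball (G w) ε := by
      simp [abs_of_pos hε, hε]
    have := hb.injOn (hball _ hx).2 hz (hconst _ hx)
    simp [hε.ne'] at this
  · refine (Complex.analyticAt_of_differentiable_on_punctured_nhds_of_continuousAt ?_
      (hGc w hw)).differentiableAt
    have hcont : Filter.Tendsto G (nhdsWithin w {w}ᶜ) (nhdsWithin (G w) {G w}ᶜ) := by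
      refine tendsto_nhdsWithin_iff.2 ⟨(hGc w hw).tendsto.mono_left nhdsWithin_le_nhds, ?_⟩
      filter_upwards [self_mem_nhdsWithin, mem_nhdsWithin_of_mem_nhds (hV.mem_nhds hw)]
        with v hv hvV hvw
      exact hv (hG.2.injOn hvV hw hvw)
    filter_upwards [hcont.eventually h0, mem_nhdsWithin_of_mem_nhds (hV.mem_nhds hw)]
      with v hv hvV using hGd v hvV hv

theorem unitDisc_nontrivial : unitDisc.Nontrivial :=
  ⟨0, by simp [unitDisc], (1 / 2 : ℝ), by simp [unitDisc]; norm_num, by simp⟩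

theorem IsConformalOntoDisc.isBiholomorphic {Ω : Set ℂ} {φ : ℂ → ℂ}
    (hφ : IsConformalOntoDisc Ω φ) (hΩ : IsSimplyConnectedDomain Ω) :
    IsBiholomorphic unitDisc Ω (Function.invFunOn φ Ω) φ := by
  refine (isBiholomorphic_of_bijOn hΩ.1 hΩ.2.isPathConnected.isConnected.isPreconnected ?_
    hφ.1 hφ.2 hφ.2.invOn_invFunOn).symm
  have := hφ.2.image_eq ▸ unitDisc_nontrivial
  exact Set.nontrivial_of_image _ _ this

/-! ### The derivative of an automorphism of the disc is bounded -/

theorem norm_sq_one_sub_conj_mul_sub (b z : ℂ) :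
    ‖1 - (starRingEnd ℂ) b * z‖ ^ 2 - ‖z - b‖ ^ 2 = (1 - ‖b‖ ^ 2) * (1 - ‖z‖ ^ 2) := by
  simp only [← Complex.normSq_eq_norm_sq, Complex.normSq_apply, Complex.sub_re, Complex.sub_im,
    Complex.mul_re, Complex.mul_im, Complex.conj_re, Complex.conj_im, Complex.one_re,
    Complex.one_im]
  ring

theorem one_sub_conj_mul_ne_zero {b z : ℂ} (hb : b ∈ unitDisc) (hz : z ∈ unitDisc) :
    1 - (starRingEnd ℂ) b * z ≠ 0 := by
  simp only [unitDisc, mem_ball_zero_iff] at hb hz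
  intro h
  have : ‖(starRingEnd ℂ) b * z‖ = 1 := by rw [← sub_eq_zero.1 h, norm_one]
  rw [norm_mul, RCLike.norm_conj] at this
  nlinarith [norm_nonneg b, norm_nonneg z]

/-- The Möbius transformation of the disc which takes `b` to `0`. -/
def discMoebius (b z : ℂ) : ℂ := (z - b) / (1 - (starRingEnd ℂ) b * z)

theorem one_sub_norm_discMoebius_sq {b z : ℂ} (hb : b ∈ unitDisc) (hz : z ∈ unitDisc) :
    1 - ‖discMoebius b z‖ ^ 2 =
      (1 - ‖b‖ ^ 2) * (1 - ‖z‖ ^ 2) / ‖1 - (starRingEnd ℂ) b * z‖ ^ 2 := by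
  have h := norm_pos_iff.2 (one_sub_conj_mul_ne_zero hb hz)
  rw [discMoebius, norm_div, ← norm_sq_one_sub_conj_mul_sub, div_pow, sub_div,
    div_self (pow_pos h 2).ne']

theorem discMoebius_mem {b z : ℂ} (hb : b ∈ unitDisc) (hz : z ∈ unitDisc) :
    discMoebius b z ∈ unitDisc := by
  have h := one_sub_norm_discMoebius_sq hb hz
  have h0 := norm_pos_iff.2 (one_sub_conj_mul_ne_zero hb hz)
  simp only [unitDisc, mem_ball_zero_iff] at hb hz ⊢
  have : 0 < (1 - ‖b‖ ^ 2) * (1 - ‖z‖ ^ 2) / ‖1 - (starRingEnd ℂ) b * z‖ ^ 2 := by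
    have h1 : 0 < 1 - ‖b‖ ^ 2 := by nlinarith [norm_nonneg b]
    have h2 : 0 < 1 - ‖z‖ ^ 2 := by nlinarith [norm_nonneg z]
    positivity
  rw [← h] at this
  nlinarith [norm_nonneg (discMoebius b z)]

theorem differentiableAt_discMoebius {b z : ℂ} (hb : b ∈ unitDisc) (hz : z ∈ unitDisc) :
    DifferentiableAt ℂ (discMoebius b) z := by
  unfold discMoebius
  exact DifferentiableAt.div (by fun_prop) (by fun_prop) (one_sub_conj_mul_ne_zero hb hz)

theorem norm_deriv_discMoebius_self {b : ℂ} (hb : b ∈ unitDisc) :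
    ‖deriv (discMoebius b) b‖ = (1 - ‖b‖ ^ 2)⁻¹ := by
  have h0 := one_sub_conj_mul_ne_zero hb hb
  have h1 : HasDerivAt (discMoebius b) (1 - (starRingEnd ℂ) b * b)⁻¹ b := by
    have h2 : HasDerivAt (fun z : ℂ => 1 - (starRingEnd ℂ) b * z) (-(starRingEnd ℂ) b) b := by
      simpa using ((hasDerivAt_id b).const_mul ((starRingEnd ℂ) b)).const_sub 1
    refine (((hasDerivAt_id b).sub_const b).div h2 h0).congr_deriv ?_
    simp only [id, sub_self, zero_mul, sub_zero, one_mul]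
    field_simp
  rw [h1.deriv, norm_inv, Complex.conj_mul', ← Complex.ofReal_pow, ← Complex.ofReal_one,
    ← Complex.ofReal_sub, Complex.norm_real, Real.norm_of_nonneg]
  simp only [unitDisc, mem_ball_zero_iff] at hb
  nlinarith [norm_nonneg b]

/-- A weak form of the Schwarz–Pick lemma. -/
theorem norm_deriv_mul_le_of_mapsTo_unitDisc {T : ℂ → ℂ} (hT : DifferentiableOn ℂ T unitDisc)
    (hmaps : MapsTo T unitDisc unitDisc) {w : ℂ} (hw : w ∈ unitDisc) :
    ‖deriv T w‖ * (1 - ‖w‖) ≤ 1 - ‖T w‖ ^ 2 := by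
  have hw1 : ‖w‖ < 1 := by simpa [unitDisc] using hw
  have hb := hmaps hw
  have hb1 : ‖T w‖ < 1 := by simpa [unitDisc] using hb
  have hsub : Metric.ball w (1 - ‖w‖) ⊆ unitDisc := by
    intro z hz
    rw [mem_ball_iff_norm] at hz
    simp only [unitDisc, mem_ball_zero_iff]
    have := norm_sub_norm_le z w
    linarith
  have hd : DifferentiableOn ℂ (discMoebius (T w) ∘ T) (Metric.ball w (1 - ‖w‖)) := fun z hz =>
    ((differentiableAt_discMoebius hb (hmaps (hsub hz))).comp z (hT.differentiableAt
      (Metric.isOpen_ball.mem_nhds (hsub hz)))).differentiableWithinAt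
  have hm : MapsTo (discMoebius (T w) ∘ T) (Metric.ball w (1 - ‖w‖))
      (Metric.closedBall ((discMoebius (T w) ∘ T) w) 1) := by
    intro z hz
    have h0 : (discMoebius (T w) ∘ T) w = 0 := by simp [discMoebius]
    rw [h0]
    exact Metric.ball_subset_closedBall (discMoebius_mem hb (hmaps (hsub hz)))
  -- The Schwarz estimate on the ball of radius `1 - ‖w‖` about `w` suffices; it costs `1 - ‖w‖` in
  -- place of the sharp `1 - ‖w‖²`.
  have key := Complex.norm_deriv_le_div_of_mapsTo_ball hd hm (by linarith)
  rw [deriv_comp w (differentiableAt_discMoebius hb hb)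
    (hT.differentiableAt (Metric.isOpen_ball.mem_nhds hw)), norm_mul,
    norm_deriv_discMoebius_self hb, le_div_iff₀ (by linarith)] at key
  have hpos : 0 < 1 - ‖T w‖ ^ 2 := by nlinarith [norm_nonneg (T w)]
  rw [mul_assoc, inv_mul_le_iff₀ hpos] at key
  linarith

/-- Schwarz's lemma for `S` followed by the Möbius map taking `S 0` to `0`, together with `|1 -
conj(S 0) S z| ≥ 1 - |S 0|`. It controls how fast `S` can push points towards the circle. -/
theorem one_sub_norm_sq_le_of_mapsTo_unitDisc {S : ℂ → ℂ} (hS : DifferentiableOn ℂ S unitDisc)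
    (hmaps : MapsTo S unitDisc unitDisc) {z : ℂ} (hz : z ∈ unitDisc) :
    (1 - ‖z‖ ^ 2) * (1 - ‖S 0‖) ^ 2 ≤ 1 - ‖S z‖ ^ 2 := by
  have h0 : (0 : ℂ) ∈ unitDisc := by simp [unitDisc]
  have hc := hmaps h0
  have hSz := hmaps hz
  have key : ‖discMoebius (S 0) (S z)‖ ≤ ‖z‖ := by
    refine Complex.norm_le_norm_of_mapsTo_ball (f := discMoebius (S 0) ∘ S) (R := 1)
      (fun w hw => ((differentiableAt_discMoebius hc (hmaps hw)).comp w (hS.differentiableAt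
        (Metric.isOpen_ball.mem_nhds hw))).differentiableWithinAt)
      (fun w hw => Metric.ball_subset_closedBall (discMoebius_mem hc (hmaps hw)))
      (by simp [discMoebius]) (by simpa [unitDisc] using hz)
  have h1 := one_sub_norm_discMoebius_sq hc hSz
  have hpos := norm_pos_iff.2 (one_sub_conj_mul_ne_zero hc hSz)
  rw [eq_div_iff (by positivity)] at h1
  have h2 : 1 - ‖S 0‖ ≤ ‖1 - (starRingEnd ℂ) (S 0) * S z‖ := by
    have h3 := norm_sub_norm_le (1 : ℂ) ((starRingEnd ℂ) (S 0) * S z)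
    rw [norm_one, norm_mul, RCLike.norm_conj] at h3
    simp only [unitDisc, mem_ball_zero_iff] at hc hSz
    nlinarith [norm_nonneg (S 0)]
  simp only [unitDisc, mem_ball_zero_iff] at hc hSz hz
  have h4 : (1 - ‖S 0‖) ^ 2 ≤ ‖1 - (starRingEnd ℂ) (S 0) * S z‖ ^ 2 :=
    pow_le_pow_left₀ (by linarith) h2 2
  have h5 : 0 ≤ 1 - ‖z‖ ^ 2 := by nlinarith [norm_nonneg z]
  have h6 : 1 - ‖z‖ ^ 2 ≤ 1 - ‖discMoebius (S 0) (S z)‖ ^ 2 := by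
    nlinarith [norm_nonneg (discMoebius (S 0) (S z))]
  have h7 : 0 ≤ 1 - ‖S z‖ ^ 2 := by nlinarith [norm_nonneg (S z)]
  calc (1 - ‖z‖ ^ 2) * (1 - ‖S 0‖) ^ 2
      ≤ (1 - ‖discMoebius (S 0) (S z)‖ ^ 2) * ‖1 - (starRingEnd ℂ) (S 0) * S z‖ ^ 2 :=
        mul_le_mul h6 h4 (sq_nonneg _) (h5.trans h6)
    _ = (1 - ‖S 0‖ ^ 2) * (1 - ‖S z‖ ^ 2) := h1
    _ ≤ 1 * (1 - ‖S z‖ ^ 2) := by gcongr; nlinarith [norm_nonneg (S 0)]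
    _ = _ := one_mul _

/-- Schwarz–Pick bounds `|T'(w)| (1 - |w|)` by `1 - |T w|²`, and the preceding estimate for the
inverse `S` at `T w` bounds that by a multiple of `1 - |w|²`. The explicit form of the automorphisms
is not needed. -/
theorem IsBiholomorphic.exists_norm_deriv_le {T S : ℂ → ℂ}
    (h : IsBiholomorphic unitDisc unitDisc T S) :
    ∃ C : ℝ, 0 < C ∧ ∀ w ∈ unitDisc, ‖deriv T w‖ ≤ C := by
  have hc := h.mapsTo_inv (show (0 : ℂ) ∈ unitDisc by simp [unitDisc])
  have hd : 0 < (1 - ‖S 0‖) ^ 2 := by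
    simp only [unitDisc, mem_ball_zero_iff] at hc
    exact pow_pos (by linarith) 2
  refine ⟨2 / (1 - ‖S 0‖) ^ 2, by positivity, fun w hw => ?_⟩
  have h1 := norm_deriv_mul_le_of_mapsTo_unitDisc h.differentiableOn h.mapsTo hw
  have h2 := one_sub_norm_sq_le_of_mapsTo_unitDisc h.differentiableOn_inv h.mapsTo_inv
    (h.mapsTo hw)
  rw [h.leftInvOn hw] at h2
  rw [le_div_iff₀ hd]
  simp only [unitDisc, mem_ball_zero_iff] at hw
  have h3 : 1 - ‖w‖ ^ 2 ≤ 2 * (1 - ‖w‖) := by nlinarith [norm_nonneg w]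
  have h4 : ‖deriv T w‖ * (1 - ‖S 0‖) ^ 2 * (1 - ‖w‖) ≤ 2 * (1 - ‖w‖) := by nlinarith
  exact le_of_mul_le_mul_right h4 (by linarith)

/-- With `ψ₂ = ψ₁ ∘ T` for a disc automorphism `T`, the factor `|T'|^α` is at most `C^{α-2} |T'|²`,
and `|T'|²` is the Jacobian of `T`. -/
theorem setLIntegral_enorm_deriv_rpow_lt_top {Ω : Set ℂ} {ψ₁ φ₁ ψ₂ φ₂ : ℂ → ℂ}
    (h₁ : IsBiholomorphic unitDisc Ω ψ₁ φ₁) (h₂ : IsBiholomorphic unitDisc Ω ψ₂ φ₂) {α : ℝ}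
    (hα : 2 ≤ α) (hfin : ∫⁻ w in unitDisc, ‖deriv ψ₁ w‖ₑ ^ α < ⊤) :
    ∫⁻ w in unitDisc, ‖deriv ψ₂ w‖ₑ ^ α < ⊤ := by
  have hT := h₁.symm.comp h₂
  obtain ⟨C, hC, hbound⟩ := hT.exists_norm_deriv_le
  set T := φ₁ ∘ ψ₂
  have hderiv : ∀ w ∈ unitDisc, deriv ψ₂ w = deriv ψ₁ (T w) * deriv T w := by
    intro w hw
    rw [← deriv_comp w (h₁.differentiableAt (hT.mapsTo hw)) (hT.differentiableAt hw)]
    refine Filter.EventuallyEq.deriv_eq ?_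
    filter_upwards [hT.isOpen_source.mem_nhds hw] with v hv
    exact (h₁.rightInvOn (h₂.mapsTo hv)).symm
  have hle : ∀ w ∈ unitDisc, ‖deriv ψ₂ w‖ₑ ^ α ≤
      ENNReal.ofReal C ^ (α - 2) * (‖deriv T w‖ₑ ^ (2 : ℝ) * ‖deriv ψ₁ (T w)‖ₑ ^ α) := by
    intro w hw
    have h0 : ‖deriv T w‖ₑ ≠ 0 := by simpa using hT.deriv_ne_zero hw
    have hCw : ‖deriv T w‖ₑ ≤ ENNReal.ofReal C := by
      rw [← ofReal_norm]
      exact ENNReal.ofReal_le_ofReal (hbound w hw)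
    rw [hderiv w hw, enorm_mul, ENNReal.mul_rpow_of_nonneg _ _ (by linarith), mul_comm,
      ← mul_assoc]
    gcongr
    calc ‖deriv T w‖ₑ ^ α = ‖deriv T w‖ₑ ^ (α - 2) * ‖deriv T w‖ₑ ^ (2 : ℝ) := by
          rw [← ENNReal.rpow_add _ _ h0 enorm_ne_top]; ring_nf
      _ ≤ _ := by gcongr
  refine (setLIntegral_mono' hT.isOpen_source.measurableSet hle).trans_lt ?_
  rw [lintegral_const_mul' _ _ (ENNReal.rpow_ne_top_of_nonneg (by linarith) ENNReal.ofReal_ne_top),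
    ← hT.setLIntegral_eq fun w => ‖deriv ψ₁ w‖ₑ ^ α]
  exact ENNReal.mul_lt_top (ENNReal.rpow_lt_top_of_nonneg (by linarith) ENNReal.ofReal_ne_top) hfin

/-! ### Weak gradients under conformal maps. -/

theorem IsBiholomorphic.locallyIntegrableOn_comp {E : Type*} [NormedAddCommGroup E]
    [NormedSpace ℝ E] {U V : Set ℂ} {φ ψ : ℂ → ℂ} (h : IsBiholomorphic V U ψ φ) {u : ℂ → E}
    (hu : LocallyIntegrableOn u U) : LocallyIntegrableOn (fun w => u (ψ w)) V := by
  rw [locallyIntegrableOn_iff h.isOpen_source.isLocallyClosed]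
  rw [locallyIntegrableOn_iff h.isOpen_target.isLocallyClosed] at hu
  intro K hKV hK
  have hL : IsCompact (ψ '' K) := hK.image_of_continuousOn (h.continuousOn.mono hKV)
  have hLU : ψ '' K ⊆ U := (image_mono hKV).trans h.mapsTo.image_subset
  have hφL : φ '' (ψ '' K) = K := (h.leftInvOn.mono hKV).image_image
  rw [← hφL, h.symm.integrableOn_image_iff hL.measurableSet hLU]
  refine ((hu _ hLU hL).continuousOn_smul ((h.symm.continuousOn_deriv.mono hLU).norm.pow 2) hL).congr_fun (fun z hz => ?_)
    hL.measurableSet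
  simp only [h.rightInvOn (hLU hz), Pi.pow_apply]

theorem MeasureTheory.LocallyIntegrableOn.integrableOn_mul_of_compact_support {U L : Set ℂ}
    {u a : ℂ → ℝ} (hU : IsOpen U) (hu : LocallyIntegrableOn u U) (ha : Continuous a)
    (hL : IsCompact L) (hLU : L ⊆ U) (h0 : ∀ z ∈ U, z ∉ L → a z = 0) :
    IntegrableOn (fun z => u z * a z) U := by
  rw [locallyIntegrableOn_iff hU.isLocallyClosed] at hu
  refine ((hu L hLU hL).mul_continuousOn ha.continuousOn hL).of_forall_sdiff_eq_zero
    hU.measurableSet fun z hz => ?_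
  simp [h0 z hz.1 hz.2]

/-- Extension by zero of a smooth function with compact support in an open set. -/
theorem contDiff_indicator_of_compact_support {U L : Set ℂ} {a : ℂ → ℝ} (hU : IsOpen U)
    (ha : ∀ z ∈ U, ContDiffAt ℝ ∞ a z) (hL : IsCompact L) (hLU : L ⊆ U)
    (h0 : ∀ z ∈ U, z ∉ L → a z = 0) :
    ContDiff ℝ ∞ (U.indicator a) ∧ HasCompactSupport (U.indicator a) ∧
      tsupport (U.indicator a) ⊆ L := by
  have hz : ∀ z ∉ L, U.indicator a z = 0 := fun z hz => by
    by_cases hzU : z ∈ U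
    · rw [indicator_of_mem hzU, h0 z hzU hz]
    · exact indicator_of_notMem hzU _
  refine ⟨contDiff_iff_contDiffAt.2 fun z => ?_, HasCompactSupport.intro hL hz, ?_⟩
  · by_cases hzL : z ∈ L
    · refine (ha z (hLU hzL)).congr_of_eventuallyEq ?_
      filter_upwards [hU.mem_nhds (hLU hzL)] with w hw using indicator_of_mem hw _
    · refine (contDiffAt_const (c := (0 : ℝ))).congr_of_eventuallyEq ?_
      filter_upwards [hL.isClosed.isOpen_compl.mem_nhds hzL] with w hw using hz w hw
  · refine closure_minimal (fun z hzs => ?_) hL.isClosed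
    by_contra hzL
    exact hzs (hz z hzL)

/-- The test function `η` on `V` is moved to `U` as the vector field `(η ∘ φ) X` with `X = v ·
conj(φ')`. Being antiholomorphic, `X` is divergence free, and `φ' X = |φ'|² v`; hence the field has
divergence `|φ'|² (∂_v η) ∘ φ`, precisely the integrand after the change of variables. Its two
components are admissible test functions for `u`. -/
theorem HasWeakGradient.comp {U V : Set ℂ} {φ ψ : ℂ → ℂ} (h : IsBiholomorphic V U ψ φ)
    {u : ℂ → ℝ} {g : ℂ → ℂ} (hu : HasWeakGradient U u g) :
    HasWeakGradient V (fun w => u (ψ w))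
      (fun w => (starRingEnd ℂ) (deriv ψ w) * g (ψ w)) := by
  obtain ⟨hui, hgi, hweak⟩ := hu
  refine ⟨h.locallyIntegrableOn_comp hui, ?_, ?_⟩
  · refine (h.locallyIntegrableOn_comp hgi).continuousOn_mul ?_ h.isOpen_source.isLocallyClosed
    exact Complex.continuous_conj.comp_continuousOn h.continuousOn_deriv
  intro η hη hηc hηV v
  have hU := h.isOpen_target
  set L := ψ '' tsupport η with hLdef
  have hL : IsCompact L := IsCompact.image_of_continuousOn hηc (h.continuousOn.mono hηV)
  have hLU : L ⊆ U := (image_mono hηV).trans h.mapsTo.image_subset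
  have hη0 : ∀ z ∈ U, z ∉ L → η (φ z) = 0 := by
    intro z hz hzL
    by_contra hne
    exact hzL ⟨φ z, subset_tsupport _ hne, h.rightInvOn hz⟩
  set X : ℂ → ℂ := fun z => v * (starRingEnd ℂ) (deriv φ z) with hX
  have hφs : ∀ z ∈ U, ContDiffAt ℝ ∞ φ z := fun z hz =>
    ((h.symm.contDiffAt hz).restrict_scalars ℝ).of_le le_top
  have hXs : ∀ z ∈ U, ContDiffAt ℝ ∞ X z := fun z hz =>
    contDiffAt_const.mul ((Complex.conjCLE.contDiff.contDiffAt).comp z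
      (((h.symm.contDiffAt_deriv hz).restrict_scalars ℝ).of_le le_top))
  have hηφ : ∀ z ∈ U, ContDiffAt ℝ ∞ (fun z => η (φ z)) z := fun z hz =>
    hη.contDiffAt.comp z (hφs z hz)
  have hζs : ∀ e : ℂ, ∀ z ∈ U, ContDiffAt ℝ ∞ (fun z => η (φ z) * inner ℝ (X z) e) z :=
    fun e z hz => (hηφ z hz).mul ((hXs z hz).inner ℝ contDiffAt_const)
  set ζ : ℂ → ℂ → ℝ := fun e => U.indicator fun z => η (φ z) * inner ℝ (X z) e with hζ
  have hζt : ∀ e, ContDiff ℝ ∞ (ζ e) ∧ HasCompactSupport (ζ e) ∧ tsupport (ζ e) ⊆ L := fun e =>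
    contDiff_indicator_of_compact_support hU (hζs e) hL hLU
      fun z hz hzL => by simp [hη0 z hz hzL]
  have hfd : ∀ e, ∀ z ∈ U, fderiv ℝ (ζ e) z e =
      fderiv ℝ (fun z => η (φ z)) z e * inner ℝ (X z) e +
        η (φ z) * inner ℝ (fderiv ℝ X z e) e := by
    intro e z hz
    have h1 : ζ e =ᶠ[nhds z] fun z => η (φ z) * inner ℝ (X z) e := by
      filter_upwards [hU.mem_nhds hz] with w hw using indicator_of_mem hw _
    have h2 : HasFDerivAt (fun z => η (φ z)) _ z :=
      ((hηφ z hz).differentiableAt (by simp)).hasFDerivAt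
    have h3 : HasFDerivAt X _ z := ((hXs z hz).differentiableAt (by simp)).hasFDerivAt
    have h4 := (h2.mul (h3.inner ℝ (hasFDerivAt_const e z))).fderiv
    rw [h1.fderiv_eq]
    refine (DFunLike.congr_fun h4 e).trans ?_
    simp [fderivInnerCLM_apply]
    ring
  have hdiv : ∀ z ∈ U, fderiv ℝ (ζ 1) z 1 + fderiv ℝ (ζ Complex.I) z Complex.I =
      ‖deriv φ z‖ ^ 2 * fderiv ℝ η (φ z) v := by
    intro z hz
    have hcomp : ∀ e, fderiv ℝ (fun z => η (φ z)) z e = fderiv ℝ η (φ z) (e * deriv φ z) := by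
      intro e
      have h1 := (hη.differentiable (by simp) (φ z)).hasFDerivAt.comp z
        ((h.symm.differentiableAt hz).hasDerivAt.hasFDerivAt.restrictScalars ℝ)
      refine (DFunLike.congr_fun h1.fderiv e).trans ?_
      simp
    have hXd : ∀ e, fderiv ℝ X z e = v * (starRingEnd ℂ) (e * deriv (deriv φ) z) := by
      intro e
      have h1 := ((h.symm.contDiffAt_deriv hz).differentiableAt
        (by simp)).hasDerivAt.hasFDerivAt.restrictScalars ℝ
      have h2 := ((Complex.conjCLE : ℂ →L[ℝ] ℂ).hasFDerivAt.comp z h1).const_mul v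
      refine (DFunLike.congr_fun h2.fderiv e).trans ?_
      simp
    have hlin : ∀ c : ℂ, fderiv ℝ η (φ z) c =
        c.re * fderiv ℝ η (φ z) 1 + c.im * fderiv ℝ η (φ z) Complex.I := by
      intro c
      conv_lhs => rw [← Complex.re_add_im c]
      rw [map_add, ← Complex.real_smul, ← mul_one (c.re : ℂ), ← Complex.real_smul, map_smul,
        map_smul, smul_eq_mul, smul_eq_mul]
    rw [hfd 1 z hz, hfd Complex.I z hz, hcomp, hcomp, hXd, hXd, hlin v, hlin (1 * _),
      hlin (Complex.I * _), hX]
    simp only [Complex.inner, ← Complex.normSq_eq_norm_sq, Complex.normSq_apply, Complex.mul_re,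
      Complex.mul_im, Complex.conj_re, Complex.conj_im, Complex.I_re, Complex.I_im,
      Complex.one_re, Complex.one_im, map_mul]
    ring
  have hint : ∀ e, IntegrableOn (fun z => u z * fderiv ℝ (ζ e) z e) U := fun e =>
    hui.integrableOn_mul_of_compact_support hU
      (((hζt e).1.continuous_fderiv (by simp)).clm_apply continuous_const) hL hLU
      fun z _ hzL => by
        rw [fderiv_of_notMem_tsupport ℝ fun hz => hzL ((hζt e).2.2 hz)]
        rfl
  have hint' : ∀ e, IntegrableOn (fun z => inner ℝ (g z) e * ζ e z) U := fun e => by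
    refine LocallyIntegrableOn.integrableOn_mul_of_compact_support (L := L) hU ?_
      (hζt e).1.continuous hL hLU fun z _ hzL => ?_
    · rw [locallyIntegrableOn_iff hU.isLocallyClosed] at hgi ⊢
      exact fun K hK hKc => (hgi K hK hKc).inner_const e
    · exact image_eq_zero_of_notMem_tsupport fun hz => hzL ((hζt e).2.2 hz)
  calc ∫ w in V, u (ψ w) * fderiv ℝ η w v
      = ∫ z in U, (u z * fderiv ℝ (ζ 1) z 1 + u z * fderiv ℝ (ζ Complex.I) z Complex.I) := by
        rw [h.symm.setIntegral_eq]
        refine setIntegral_congr_fun hU.measurableSet fun z hz => ?_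
        simp only [h.rightInvOn hz, ← mul_add, hdiv z hz, smul_eq_mul]
        ring
    _ = -∫ z in U, (inner ℝ (g z) 1 * ζ 1 z + inner ℝ (g z) Complex.I * ζ Complex.I z) := by
        rw [integral_add (hint 1) (hint Complex.I), integral_add (hint' 1) (hint' Complex.I),
          hweak _ (hζt 1).1 (hζt 1).2.1 ((hζt 1).2.2.trans hLU), hweak _ (hζt Complex.I).1
          (hζt Complex.I).2.1 ((hζt Complex.I).2.2.trans hLU)]
        ring
    _ = _ := by
        rw [h.symm.setIntegral_eq]
        congr 1
        refine setIntegral_congr_fun hU.measurableSet fun z hz => ?_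
        -- Both integrands agree because `ψ'(φ z) φ'(z) = 1`; the real and imaginary parts of this
        -- identity enter the linear combination.
        have hinv := h.symm.deriv_inv_mul_deriv hz
        have hre := congrArg Complex.re hinv
        have him := congrArg Complex.im hinv
        simp only [h.rightInvOn hz, hζ, indicator_of_mem hz, hX, Complex.inner, smul_eq_mul,
          ← Complex.normSq_eq_norm_sq, Complex.normSq_apply, Complex.mul_re, Complex.mul_im,
          Complex.conj_re, Complex.conj_im, Complex.I_re, Complex.I_im, Complex.one_re,
          Complex.one_im, map_mul] at hre him ⊢
        linear_combination
          (-η (φ z) * (((g z).re * v.re + (g z).im * v.im) * (deriv φ z).re +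
            ((g z).re * v.im - (g z).im * v.re) * (deriv φ z).im)) * hre +
          (η (φ z) * (((g z).re * v.im - (g z).im * v.re) * (deriv φ z).re -
            ((g z).re * v.re + (g z).im * v.im) * (deriv φ z).im)) * him

/-! ### Young's inequality and Riesz potentials. -/

/-- Young's convolution inequality. -/
theorem lintegral_rpow_lintegral_mul_sub_le {h κ : ℂ → ℝ≥0∞} (hh : Measurable h)
    (hκ : Measurable κ) {q r s : ℝ} (hq : 1 ≤ q) (hqr : q ≤ r) (hs : 0 < s)
    (hqrs : 1 / s = 1 + 1 / r - 1 / q) :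
    ∫⁻ x, (∫⁻ z, h z * κ (x - z)) ^ r ≤
      (∫⁻ y, κ y ^ s) ^ (r / s) * (∫⁻ z, h z ^ q) ^ (r / q) := by
  have hq0 : 0 < q := by linarith
  have hr0 : 0 < r := by linarith
  set K := ∫⁻ y, κ y ^ s with hK
  set A := ∫⁻ z, h z ^ q with hA
  have e1 : 0 ≤ 1 / r := by positivity
  have e2 : 0 ≤ 1 / q - 1 / r := sub_nonneg.2 (one_div_le_one_div_of_le hq0 hqr)
  have e3 : 0 ≤ 1 - 1 / q := sub_nonneg.2 (by rw [div_le_one hq0]; exact hq)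
  have es : s * (1 / r + (1 - 1 / q)) = 1 := by
    rw [show 1 / r + (1 - 1 / q) = 1 / s by linarith]; field_simp
  have hmeasκ : ∀ x, Measurable fun z => κ (x - z) := fun x =>
    hκ.comp (measurable_const.sub measurable_id)
  -- Three-factor Hölder for `hκ = (h^q κ^s)^{1/r} (h^q)^{1/q-1/r} (κ^s)^{1-1/q}`; `es` says that
  -- the powers of `κ` add up to one.
  have hpt : ∀ x, (∫⁻ z, h z * κ (x - z)) ≤
      (∫⁻ z, h z ^ q * κ (x - z) ^ s) ^ (1 / r) * A ^ (1 / q - 1 / r) * K ^ (1 - 1 / q) := by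
    intro x
    have h1 := ENNReal.lintegral_prod_norm_pow_le (μ := (volume : Measure ℂ)) Finset.univ
      (f := ![fun z => h z ^ q * κ (x - z) ^ s, fun z => h z ^ q, fun z => κ (x - z) ^ s])
      (p := ![1 / r, 1 / q - 1 / r, 1 - 1 / q]) (fun i _ => by
        fin_cases i
        · exact ((hh.pow_const q).mul ((hmeasκ x).pow_const s)).aemeasurable
        · exact (hh.pow_const q).aemeasurable
        · exact ((hmeasκ x).pow_const s).aemeasurable)
      (by simp [Fin.sum_univ_three])
      (fun i _ => by fin_cases i <;> assumption)
    simp only [Fin.prod_univ_three, Matrix.cons_val_zero, Matrix.cons_val_one,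
      Matrix.cons_val_two, Matrix.tail_cons, Matrix.head_cons] at h1
    rw [lintegral_sub_left_eq_self (fun y => κ y ^ s) x] at h1
    refine le_trans (lintegral_mono fun z => le_of_eq ?_) h1
    rw [ENNReal.mul_rpow_of_nonneg _ _ e1]
    simp only [← ENNReal.rpow_mul]
    calc h z * κ (x - z)
        = h z ^ (q * (1 / r) + q * (1 / q - 1 / r)) *
            κ (x - z) ^ (s * (1 / r) + s * (1 - 1 / q)) := by
          rw [← mul_add, ← mul_add, es, show 1 / r + (1 / q - 1 / r) = 1 / q by ring,
            mul_one_div_cancel hq0.ne', ENNReal.rpow_one, ENNReal.rpow_one]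
      _ = _ := by
          rw [ENNReal.rpow_add_of_nonneg _ _ (by positivity) (by positivity),
            ENNReal.rpow_add_of_nonneg _ _ (by positivity) (by positivity)]
          ring
  have hfub : ∫⁻ x, ∫⁻ z, h z ^ q * κ (x - z) ^ s = A * K := by
    rw [lintegral_lintegral_swap]
    · have : ∀ z, ∫⁻ x, h z ^ q * κ (x - z) ^ s = h z ^ q * K := fun z => by
        have hm : Measurable fun x => κ (x - z) := hκ.comp (measurable_id.sub_const z)
        rw [lintegral_const_mul _ (hm.pow_const s)]
        congr 1
        exact lintegral_sub_right_eq_self (fun y => κ y ^ s) z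
      simp_rw [this]
      rw [lintegral_mul_const _ (hh.pow_const q)]
    · exact (((hh.comp measurable_snd).pow_const q).mul
        ((hκ.comp (measurable_fst.sub measurable_snd)).pow_const s)).aemeasurable
  calc ∫⁻ x, (∫⁻ z, h z * κ (x - z)) ^ r
      ≤ ∫⁻ x, (∫⁻ z, h z ^ q * κ (x - z) ^ s) *
          (A ^ ((1 / q - 1 / r) * r) * K ^ ((1 - 1 / q) * r)) := by
        refine lintegral_mono fun x => ?_
        refine (ENNReal.rpow_le_rpow (hpt x) hr0.le).trans_eq ?_
        rw [ENNReal.mul_rpow_of_nonneg _ _ hr0.le, ENNReal.mul_rpow_of_nonneg _ _ hr0.le,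
          ← ENNReal.rpow_mul, ← ENNReal.rpow_mul, ← ENNReal.rpow_mul, one_div_mul_cancel hr0.ne',
          ENNReal.rpow_one, mul_assoc]
    _ = A * K * (A ^ ((1 / q - 1 / r) * r) * K ^ ((1 - 1 / q) * r)) := by
        rw [lintegral_mul_const, hfub]
        exact Measurable.lintegral_prod_right' (f := fun p : ℂ × ℂ => h p.2 ^ q * κ (p.1 - p.2) ^ s)
          (((hh.comp measurable_snd).pow_const q).mul
          ((hκ.comp (measurable_fst.sub measurable_snd)).pow_const s))
    _ = (K ^ (1 : ℝ) * K ^ ((1 - 1 / q) * r)) * (A ^ (1 : ℝ) * A ^ ((1 / q - 1 / r) * r)) := by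
        rw [ENNReal.rpow_one, ENNReal.rpow_one]; ring
    _ = _ := by
        rw [← ENNReal.rpow_add_of_nonneg _ _ zero_le_one (by positivity),
          ← ENNReal.rpow_add_of_nonneg _ _ zero_le_one (by positivity)]
        congr 2
        · rw [div_eq_mul_one_div r s, hqrs]; field_simp; ring
        · field_simp; ring

/-- The Riesz potential kernel `1 / |y|` of the plane, cut off at `|y| = 2`. -/
def rieszKernel : ℂ → ℝ≥0∞ := (Metric.ball 0 2).indicator fun y => ‖y‖ₑ⁻¹

theorem measurable_rieszKernel : Measurable rieszKernel :=
  (measurable_enorm.inv).indicator measurableSet_ball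

theorem rieszKernel_neg (y : ℂ) : rieszKernel (-y) = rieszKernel y := by
  simp [rieszKernel, indicator]

theorem lintegral_rieszKernel_rpow_lt_top {s : ℝ} (hs0 : 0 < s) (hs : s < 2) :
    ∫⁻ y, rieszKernel y ^ s < ⊤ := by
  have h1 : IntegrableOn (fun y : ℂ => ‖y‖ ^ (-s)) (Metric.ball 0 2) :=
    integrableOn_ball_of_norm_le_rpow (C := 1) (α := s) (by simp) (by simpa using hs)
      (Filter.Eventually.of_forall fun y => by
        rw [one_mul, Real.norm_of_nonneg (by positivity)])
      (measurable_norm.pow_const _).aestronglyMeasurable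
  have h2 : ∫⁻ y, rieszKernel y ^ s = ∫⁻ y in Metric.ball (0 : ℂ) 2, ‖‖y‖ ^ (-s)‖ₑ := by
    rw [← lintegral_indicator measurableSet_ball]
    refine lintegral_congr_ae ?_
    filter_upwards [Measure.ae_ne volume (0 : ℂ)] with y hy
    simp only [rieszKernel, indicator]
    split_ifs
    · rw [ENNReal.inv_rpow, ← ENNReal.rpow_neg, Real.enorm_of_nonneg (by positivity),
        ← ENNReal.ofReal_rpow_of_pos (norm_pos_iff.2 hy), ofReal_norm]
    · simp [hs0]
  rw [h2]
  exact h1.2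

theorem lintegral_rpow_neg_three_le {a : ℝ} (ha : 0 < a) :
    ∫⁻ t in Ioi a, ENNReal.ofReal (t ^ (-3 : ℝ)) = ENNReal.ofReal (1 / (2 * a ^ 2)) := by
  rw [← ofReal_integral_eq_lintegral_ofReal (integrableOn_Ioi_rpow_of_lt (by norm_num) ha),
    integral_Ioi_rpow_of_lt (by norm_num) ha]
  · congr 1
    rw [show (-3 + 1 : ℝ) = -(2 : ℕ) by norm_num, Real.rpow_neg ha.le, Real.rpow_natCast]
    field_simp
    norm_num
  · filter_upwards [ae_restrict_mem measurableSet_Ioi] with t ht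
    exact Real.rpow_nonneg (ha.trans ht).le _

theorem lintegral_comp_smul_of_pos {k : ℂ → ℝ≥0∞} (hk : Measurable k) {t : ℝ} (ht : 0 < t) :
    ∫⁻ w, k (t • w) = ENNReal.ofReal (t ^ (-2 : ℝ)) * ∫⁻ w, k w := by
  rw [← lintegral_map hk (measurable_const_smul t), Measure.map_addHaar_smul _ ht.ne',
    lintegral_smul_measure, smul_eq_mul]
  congr 2
  rw [Complex.finrank_real_complex, abs_of_pos (by positivity), Real.rpow_neg ht.le]
  norm_cast

theorem enorm_sub_le_lintegral_fderiv {F : ℂ → ℝ} (hF : ContDiff ℝ 1 F) (x w : ℂ) :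
    ‖F x - F (x + w)‖ₑ ≤ ∫⁻ t in Ioo (0 : ℝ) 1, ‖fderiv ℝ F (x + t • w)‖ₑ * ‖w‖ₑ := by
  have hd : ∀ t : ℝ, HasDerivAt (fun t : ℝ => F (x + t • w)) (fderiv ℝ F (x + t • w) w) t := by
    intro t
    have h1 : HasDerivAt (fun t : ℝ => x + t • w) w t := by
      simpa using ((hasDerivAt_id t).smul_const w).const_add x
    exact ((hF.differentiable (by simp) _).hasFDerivAt).comp_hasDerivAt t h1
  have hc : Continuous fun t : ℝ => fderiv ℝ F (x + t • w) w :=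
    ((hF.continuous_fderiv (by simp)).comp (by fun_prop)).clm_apply continuous_const
  have h2 := intervalIntegral.integral_eq_sub_of_hasDerivAt (fun t _ => hd t)
    (hc.intervalIntegrable 0 1)
  simp only [one_smul, zero_smul, add_zero] at h2
  rw [← enorm_neg, neg_sub, ← h2, intervalIntegral.integral_of_le zero_le_one,
    integral_Ioc_eq_integral_Ioo]
  exact (enorm_integral_le_lintegral_enorm _).trans
    (lintegral_mono fun t => (fderiv ℝ F (x + t • w)).le_opENorm w)

/-- Only `t > ‖w‖/2` contributes, and `∫ t⁻³` over that half-line is `2/‖w‖²`. -/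
theorem lintegral_rpow_neg_three_mul_le (w : ℂ) :
    ∫⁻ t in Ioo (0 : ℝ) 1, ENNReal.ofReal (t ^ (-3 : ℝ)) * (if ‖w‖ < 2 * t then ‖w‖ₑ else 0) ≤
      2 * rieszKernel w := by
  by_cases hw2 : ‖w‖ < 2
  swap
  · refine le_trans (le_of_eq ?_) zero_le
    rw [setLIntegral_congr_fun (g := fun _ => 0) measurableSet_Ioo, lintegral_zero]
    intro t ht
    have : ¬ ‖w‖ < 2 * t := by linarith [ht.2]
    simp [this]
  have hκ : rieszKernel w = ‖w‖ₑ⁻¹ := by simp [rieszKernel, hw2]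
  rcases eq_or_ne w 0 with rfl | hw0
  · simp [hκ]
  have hpos : 0 < ‖w‖ := norm_pos_iff.2 hw0
  calc _ ≤ ∫⁻ t, (Ioi (‖w‖ / 2)).indicator (fun t => ENNReal.ofReal (t ^ (-3 : ℝ))) t * ‖w‖ₑ := by
        refine (setLIntegral_le_lintegral _ _).trans (lintegral_mono fun t => ?_)
        by_cases h : ‖w‖ < 2 * t
        · rw [if_pos h, indicator_of_mem (show t ∈ Ioi (‖w‖ / 2) by
            rw [mem_Ioi]; linarith)]
        · simp [h]
    _ = ENNReal.ofReal (1 / (2 * (‖w‖ / 2) ^ 2)) * ‖w‖ₑ := by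
        rw [lintegral_mul_const' _ _ enorm_ne_top, lintegral_indicator measurableSet_Ioi,
          lintegral_rpow_neg_three_le (by positivity)]
    _ = _ := by
        rw [hκ, ← ofReal_norm, ← ENNReal.ofReal_mul (by positivity),
          ← ENNReal.ofReal_inv_of_pos hpos, ← ENNReal.ofReal_ofNat,
          ← ENNReal.ofReal_mul (by positivity)]
        congr 1
        field_simp

/-- The difference is integrated along the segment from `x` to `x + w`, which stays in the convex
ball. Replacing `t w` by `w` and integrating in `t` first leaves the kernel `2/|w|`. Points of the
ball are less than `2` apart, whence the cutoff in `rieszKernel`. -/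
theorem setLIntegral_enorm_sub_le_riesz {F : ℂ → ℝ} (hF : ContDiff ℝ 1 F) {R : ℝ} (hR : R ≤ 1)
    {x : ℂ} (hx : x ∈ Metric.ball (0 : ℂ) R) :
    ∫⁻ y in Metric.ball (0 : ℂ) R, ‖F x - F y‖ₑ ≤
      2 * ∫⁻ z, (Metric.ball (0 : ℂ) R).indicator (fun z => ‖fderiv ℝ F z‖ₑ) z *
        rieszKernel (x - z) := by
  set B := Metric.ball (0 : ℂ) R
  set h := B.indicator (fun z => ‖fderiv ℝ F z‖ₑ) with hh
  have hhm : Measurable h :=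
    (hF.continuous_fderiv (by simp)).enorm.measurable.indicator measurableSet_ball
  have hNm : Measurable fun p : ℝ × ℂ => if ‖p.2‖ < 2 * p.1 then ‖p.2‖ₑ else 0 :=
    Measurable.ite (measurableSet_lt measurable_snd.norm (measurable_fst.const_mul 2))
      measurable_snd.enorm measurable_const
  have hKm : Measurable fun p : ℝ × ℂ => h (x + p.2) *
      (ENNReal.ofReal (p.1 ^ (-3 : ℝ)) * if ‖p.2‖ < 2 * p.1 then ‖p.2‖ₑ else 0) :=
    (hhm.comp (measurable_snd.const_add x)).mul
      ((measurable_fst.pow_const _).ennreal_ofReal.mul hNm)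
  have hwm : Measurable fun w : ℂ => if ‖w‖ < 2 * 1 then ‖w‖ₑ else 0 :=
    hNm.comp (measurable_const (a := (1 : ℝ)) |>.prodMk measurable_id)
  calc ∫⁻ y in B, ‖F x - F y‖ₑ
      = ∫⁻ w, B.indicator (fun y => ‖F x - F y‖ₑ) (x + w) := by
        rw [lintegral_add_left_eq_self (fun y => B.indicator (fun y => ‖F x - F y‖ₑ) y) x,
          lintegral_indicator measurableSet_ball]
    _ ≤ ∫⁻ w, ∫⁻ t in Ioo (0 : ℝ) 1, h (x + t • w) * if ‖w‖ < 2 * 1 then ‖w‖ₑ else 0 := by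
        refine lintegral_mono fun w => ?_
        by_cases hw : x + w ∈ B
        swap
        · simp [hw]
        rw [indicator_of_mem hw]
        have hw2 : ‖w‖ < 2 * 1 := by
          have h1 := norm_sub_le (x + w) x
          rw [add_sub_cancel_left] at h1
          rw [mem_ball_zero_iff] at hw hx
          linarith
        refine (enorm_sub_le_lintegral_fderiv hF x w).trans (le_of_eq ?_)
        refine setLIntegral_congr_fun measurableSet_Ioo fun t ht => ?_
        have hmem : x + t • w ∈ B := by
          have := (convex_ball (0 : ℂ) R).add_smul_sub_mem hx hw ⟨ht.1.le, ht.2.le⟩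
          rwa [add_sub_cancel_left] at this
        simp only [hh, indicator_of_mem hmem, if_pos hw2]
    _ = ∫⁻ t in Ioo (0 : ℝ) 1, ∫⁻ w, h (x + t • w) * if ‖w‖ < 2 * 1 then ‖w‖ₑ else 0 := by
        refine lintegral_lintegral_swap (Measurable.aemeasurable ?_)
        exact (hhm.comp (by fun_prop)).mul (hwm.comp measurable_fst)
    -- The weight `t⁻³` is the planar Jacobian `t⁻²` times the `t⁻¹` coming from the length `‖w‖`.
    _ = ∫⁻ t in Ioo (0 : ℝ) 1, ∫⁻ w, h (x + w) *
          (ENNReal.ofReal (t ^ (-3 : ℝ)) * if ‖w‖ < 2 * t then ‖w‖ₑ else 0) := by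
        refine setLIntegral_congr_fun measurableSet_Ioo fun t ht => ?_
        have ht0 : 0 < t := ht.1
        have hkm : Measurable fun w : ℂ => h (x + w) *
            (ENNReal.ofReal t⁻¹ * if ‖w‖ < 2 * t then ‖w‖ₑ else 0) :=
          (hhm.comp (measurable_const_add x)).mul
            (measurable_const.mul (hNm.comp (measurable_const (a := t) |>.prodMk measurable_id)))
        have h1 := lintegral_comp_smul_of_pos hkm ht0
        rw [← lintegral_const_mul _ hkm] at h1
        refine Eq.trans (lintegral_congr fun w => ?_) (h1.trans (lintegral_congr fun w => ?_))
        · have hiff : ‖t • w‖ < 2 * t ↔ ‖w‖ < 2 * 1 := by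
            rw [norm_smul, Real.norm_of_nonneg ht0.le, mul_comm t, mul_one,
              mul_lt_mul_iff_left₀ ht0]
          simp only [hiff]
          congr 1
          split_ifs
          · rw [enorm_smul, Real.enorm_of_nonneg ht0.le, ← mul_assoc,
              ← ENNReal.ofReal_mul (by positivity), inv_mul_cancel₀ ht0.ne']
            simp
          · simp
        · rw [mul_left_comm, ← mul_assoc (ENNReal.ofReal (t ^ (-2 : ℝ))),
            ← ENNReal.ofReal_mul (by positivity), ← Real.rpow_neg_one, ← Real.rpow_add ht0]
          norm_num
    _ = ∫⁻ w, ∫⁻ t in Ioo (0 : ℝ) 1, h (x + w) *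
          (ENNReal.ofReal (t ^ (-3 : ℝ)) * if ‖w‖ < 2 * t then ‖w‖ₑ else 0) :=
        lintegral_lintegral_swap hKm.aemeasurable
    _ ≤ ∫⁻ w, h (x + w) * (2 * rieszKernel w) := by
        refine lintegral_mono fun w => ?_
        have hm : Measurable fun t : ℝ =>
            ENNReal.ofReal (t ^ (-3 : ℝ)) * if ‖w‖ < 2 * t then ‖w‖ₑ else 0 :=
          (measurable_id.pow_const _).ennreal_ofReal.mul
            (hNm.comp (measurable_id.prodMk measurable_const))
        rw [lintegral_const_mul _ hm]
        gcongr
        exact lintegral_rpow_neg_three_mul_le w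
    _ = ∫⁻ z, h z * (2 * rieszKernel (z - x)) := by
        rw [← lintegral_add_left_eq_self (fun z => h z * (2 * rieszKernel (z - x))) x]
        simp
    _ = _ := by
        rw [← lintegral_const_mul' _ _ (by norm_num)]
        refine lintegral_congr fun z => ?_
        rw [← rieszKernel_neg, neg_sub]
        ring

/-! ### Sobolev–Poincaré inequality on the disc. -/

/-- A Sobolev–Poincaré inequality for smooth functions on discs. -/
theorem exists_lintegral_enorm_sub_rpow_le_of_contDiff {q r : ℝ} (hq : 1 ≤ q) (hqr : q ≤ r)
    (hr : 1 / q - 1 / 2 < 1 / r) :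
    ∃ C : ℝ≥0∞, C ≠ ⊤ ∧ ∀ F : ℂ → ℝ, ContDiff ℝ 1 F → ∀ R : ℝ, 1 / 2 ≤ R → R ≤ 1 →
      ∫⁻ p, ‖F p.1 - F p.2‖ₑ ^ r ∂((volume.restrict (Metric.ball (0 : ℂ) R)).prod
        (volume.restrict (Metric.ball (0 : ℂ) R))) ≤
      C * (∫⁻ z in Metric.ball (0 : ℂ) R, ‖fderiv ℝ F z‖ₑ ^ q) ^ (r / q) := by
  have hq0 : 0 < q := by linarith
  have hr0 : 0 < r := by linarith
  have hr1 : 1 ≤ r := by linarith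
  have h1q : 1 / q ≤ 1 := (div_le_one hq0).2 hq
  have h1r : 0 < 1 / r := by positivity
  -- The exponent of the kernel in Young's inequality; `s < 2`, which makes `|y|^{-s}` integrable
  -- near the origin of the plane, is exactly the hypothesis `hr`.
  set s := (1 + 1 / r - 1 / q)⁻¹ with hs
  have hsi : 1 / s = 1 + 1 / r - 1 / q := by rw [hs, one_div, inv_inv]
  have hs0 : 0 < s := inv_pos.2 (by linarith)
  have hs2 : s < 2 := by
    rw [hs, inv_lt_comm₀ (by linarith) (by norm_num)]
    linarith
  have hK := lintegral_rieszKernel_rpow_lt_top hs0 hs2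
  set K := ∫⁻ y, rieszKernel y ^ s
  set m := volume (Metric.ball (0 : ℂ) (1 / 2)) with hm
  set M := volume (Metric.ball (0 : ℂ) 1) with hM
  have hm0 : m ≠ 0 := (Metric.measure_ball_pos volume _ (by norm_num)).ne'
  have hmt : m ≠ ⊤ := measure_ball_lt_top.ne
  have hMt : M ≠ ⊤ := measure_ball_lt_top.ne
  -- Bounding the area of the ball between `m` and `M` makes the constant independent of `R`, as the
  -- limit `R → 1` requires.
  refine ⟨(2 / m) ^ r * (2 ^ (r - 1) * (2 * M * K ^ (r / s))), ?_, fun F hF R hR1 hR2 => ?_⟩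
  · have := ENNReal.rpow_ne_top_of_nonneg hr0.le (ENNReal.div_ne_top (ENNReal.ofNat_ne_top (n := 2)) hm0)
    have := ENNReal.rpow_ne_top_of_nonneg (sub_nonneg.2 hr1) (ENNReal.ofNat_ne_top (n := 2))
    have := ENNReal.rpow_ne_top_of_nonneg (div_nonneg hr0.le hs0.le) hK.ne
    finiteness
  set B := Metric.ball (0 : ℂ) R
  set h := B.indicator (fun z => ‖fderiv ℝ F z‖ₑ) with hh
  have hhm : Measurable h :=
    (hF.continuous_fderiv (by simp)).enorm.measurable.indicator measurableSet_ball
  set J : ℂ → ℝ≥0∞ := fun x => ∫⁻ z, h z * rieszKernel (x - z) with hJ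
  have hJm : Measurable J := by
    refine Measurable.lintegral_prod_right' (f := fun p : ℂ × ℂ => h p.2 * rieszKernel (p.1 - p.2)) ?_
    exact (hhm.comp measurable_snd).mul
      (measurable_rieszKernel.comp (measurable_fst.sub measurable_snd))
  have hBM : volume B ≤ M := measure_mono (Metric.ball_subset_ball hR2)
  have hmB : m ≤ volume B := measure_mono (Metric.ball_subset_ball hR1)
  have hFm : Measurable F := hF.continuous.measurable
  -- The triangle inequality through a third point `w` is averaged over `w ∈ B`.
  have hpt : ∀ x ∈ B, ∀ y ∈ B, ‖F x - F y‖ₑ ≤ 2 / m * (J x + J y) := by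
    intro x hx y hy
    have h1 : m * ‖F x - F y‖ₑ ≤ 2 * J x + 2 * J y := calc
      m * ‖F x - F y‖ₑ ≤ ∫⁻ _ in B, ‖F x - F y‖ₑ := by
          rw [lintegral_const, Measure.restrict_apply_univ, mul_comm]
          gcongr
      _ ≤ ∫⁻ w in B, (‖F x - F w‖ₑ + ‖F y - F w‖ₑ) := by
          refine lintegral_mono fun w => ?_
          have h2 : F x - F y = (F x - F w) - (F y - F w) := by ring
          rw [h2]
          exact enorm_sub_le
      _ = (∫⁻ w in B, ‖F x - F w‖ₑ) + ∫⁻ w in B, ‖F y - F w‖ₑ :=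
          lintegral_add_left (hFm.const_sub _).enorm _
      _ ≤ _ := add_le_add (setLIntegral_enorm_sub_le_riesz hF hR2 hx)
          (setLIntegral_enorm_sub_le_riesz hF hR2 hy)
    rw [← mul_add, mul_comm, ← ENNReal.le_div_iff_mul_le (Or.inl hm0) (Or.inl hmt)] at h1
    rwa [ENNReal.mul_div_right_comm] at h1
  have hpt' : ∀ᵐ p ∂((volume.restrict B).prod (volume.restrict B)),
      ‖F p.1 - F p.2‖ₑ ^ r ≤ (2 / m) ^ r * (2 ^ (r - 1) * (J p.1 ^ r + J p.2 ^ r)) := by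
    have hx := (Measure.quasiMeasurePreserving_fst (μ := volume.restrict B)
      (ν := volume.restrict B)).ae (ae_restrict_mem measurableSet_ball)
    have hy := (Measure.quasiMeasurePreserving_snd (μ := volume.restrict B)
      (ν := volume.restrict B)).ae (ae_restrict_mem measurableSet_ball)
    filter_upwards [hx, hy] with p hp1 hp2
    refine (ENNReal.rpow_le_rpow (hpt _ hp1 _ hp2) hr0.le).trans ?_
    rw [ENNReal.mul_rpow_of_nonneg _ _ hr0.le]
    gcongr
    exact ENNReal.rpow_add_le_mul_rpow_add_rpow _ _ hr1
  have hJr : ∫⁻ x in B, J x ^ r ≤ K ^ (r / s) * (∫⁻ z in B, ‖fderiv ℝ F z‖ₑ ^ q) ^ (r / q) := by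
    refine (setLIntegral_le_lintegral _ _).trans
      ((lintegral_rpow_lintegral_mul_sub_le hhm measurable_rieszKernel hq hqr hs0 hsi).trans_eq ?_)
    congr 2
    rw [← lintegral_indicator measurableSet_ball]
    refine lintegral_congr fun z => ?_
    change _ = B.indicator _ z
    by_cases hz : z ∈ B
    · simp [hh, hz]
    · simp [hh, hz, hq0]
  refine (lintegral_mono_ae hpt').trans ?_
  have hm1 : Measurable fun p : ℂ × ℂ => J p.1 ^ r := (hJm.comp measurable_fst).pow_const r
  have hm2 : Measurable fun p : ℂ × ℂ => J p.2 ^ r := (hJm.comp measurable_snd).pow_const r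
  have hm12 : Measurable fun p : ℂ × ℂ => J p.1 ^ r + J p.2 ^ r := hm1.add hm2
  rw [lintegral_const_mul _ (hm12.const_mul _), lintegral_const_mul _ hm12,
    lintegral_add_left hm1, lintegral_prod _ hm1.aemeasurable, lintegral_prod _ hm2.aemeasurable]
  simp only [lintegral_const, Measure.restrict_apply_univ]
  rw [lintegral_mul_const _ (hJm.pow_const r)]
  calc _ = (2 / m) ^ r * (2 ^ (r - 1) * (2 * volume B * ∫⁻ x in B, J x ^ r)) := by ring
    _ ≤ (2 / m) ^ r * (2 ^ (r - 1) * (2 * M *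
        (K ^ (r / s) * (∫⁻ z in B, ‖fderiv ℝ F z‖ₑ ^ q) ^ (r / q)))) := by gcongr
    _ = _ := by ring

/-- The derivative of a mollification is the mollification of the weak gradient. -/
theorem HasWeakGradient.fderiv_convolution_apply {U S : Set ℂ} {f : ℂ → ℝ} {g : ℂ → ℂ}
    (h : HasWeakGradient U f g) (hU : MeasurableSet U) (hS : MeasurableSet S) (hSU : S ⊆ U)
    (hfS : IntegrableOn f S) {ρ : ℂ → ℝ} (hρ : ContDiff ℝ ∞ ρ) (hρc : HasCompactSupport ρ)
    {x : ℂ} (hx : ∀ t, x - t ∈ tsupport ρ → t ∈ S) (v : ℂ) :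
    fderiv ℝ (convolution ρ (S.indicator f) (ContinuousLinearMap.lsmul ℝ ℝ)) x v =
      ∫ t in U, inner ℝ (g t) v * ρ (x - t) := by
  have hloc : LocallyIntegrable (S.indicator f) :=
    ((integrable_indicator_iff hS).2 hfS).locallyIntegrable
  set η : ℂ → ℝ := fun t => ρ (x - t) with hη
  have hηs : ContDiff ℝ ∞ η := hρ.comp (contDiff_const.sub contDiff_id)
  have hsupp : tsupport η ⊆ (fun t => x - t) ⁻¹' tsupport ρ :=
    closure_minimal (fun t ht => subset_tsupport ρ ht)
      ((isClosed_tsupport ρ).preimage (by fun_prop))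
  have hηc : HasCompactSupport η := hρc.comp_homeomorph (Homeomorph.subLeft x)
  have hηU : tsupport η ⊆ U := fun t ht => hSU (hx t (hsupp ht))
  have hηd : ∀ t, fderiv ℝ η t v = -fderiv ℝ ρ (x - t) v := by
    intro t
    have h1 := ((hρ.differentiable (by simp) (x - t)).hasFDerivAt).comp t
      ((hasFDerivAt_id t).const_sub x)
    refine (DFunLike.congr_fun h1.fderiv v).trans ?_
    simp
  have hd := hρc.hasFDerivAt_convolution_left (μ := volume) (ContinuousLinearMap.lsmul ℝ ℝ)
    (hρ.of_le (by norm_cast)) hloc x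
  have hex := (hρc.fderiv ℝ).convolutionExists_left
    ((ContinuousLinearMap.lsmul ℝ ℝ).precompL ℂ) (μ := volume)
    (hρ.continuous_fderiv (by simp)) hloc x
  have key := h.2.2 η hηs hηc hηU v
  rw [hd.fderiv, convolution_def, ContinuousLinearMap.integral_apply hex]
  simp only [ContinuousLinearMap.precompL_apply, ContinuousLinearMap.lsmul_apply, smul_eq_mul]
  rw [← neg_inj, ← key, ← integral_sub_left_eq_self _ volume x, ← integral_neg,
    ← integral_indicator hU]
  refine integral_congr_ae (Filter.Eventually.of_forall fun t => ?_)
  simp only [sub_sub_cancel]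
  by_cases ht : t ∈ S
  · rw [indicator_of_mem ht, indicator_of_mem (hSU ht), hηd]
    ring
  · have h0 : fderiv ℝ ρ (x - t) = 0 := fderiv_of_notMem_tsupport ℝ fun h => ht (hx t h)
    by_cases htU : t ∈ U
    · rw [indicator_of_mem htU, hηd, h0]
      simp
    · rw [indicator_of_notMem htU, h0]
      simp

/-- Mollifying at scale at most `(1 - R)/2` uses only values of `f` on a compact part of the disc.
Young's inequality with a kernel of mass one shows that the `L^q` norm of the gradient does not
grow. -/
theorem HasWeakGradient.exists_contDiff_approx {f : ℂ → ℝ} {g : ℂ → ℂ}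
    (h : HasWeakGradient unitDisc f g) {R : ℝ} (hR : R < 1) {q : ℝ} (hq : 1 ≤ q) :
    ∃ F : ℕ → ℂ → ℝ, (∀ n, ContDiff ℝ 1 (F n)) ∧
      (∀ᵐ z ∂volume.restrict (Metric.ball (0 : ℂ) R),
        Filter.Tendsto (fun n => F n z) Filter.atTop (nhds (f z))) ∧
      ∀ n, ∫⁻ z in Metric.ball (0 : ℂ) R, ‖fderiv ℝ (F n) z‖ₑ ^ q ≤
        ∫⁻ z in unitDisc, ‖g z‖ₑ ^ q := by
  have hDo : IsOpen unitDisc := Metric.isOpen_ball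
  have hD : MeasurableSet unitDisc := hDo.measurableSet
  set δ := (1 - R) / 2 with hδ
  have hδ0 : 0 < δ := by linarith
  set S := Metric.closedBall (0 : ℂ) (R + δ) with hSdef
  have hS : MeasurableSet S := measurableSet_closedBall
  have hSD : S ⊆ unitDisc := Metric.closedBall_subset_ball (by linarith)
  have hfS : IntegrableOn f S :=
    (locallyIntegrableOn_iff hDo.isLocallyClosed).1 h.1 S hSD (isCompact_closedBall _ _)
  have hloc : LocallyIntegrable (S.indicator f) :=
    ((integrable_indicator_iff hS).2 hfS).locallyIntegrable
  -- The fixed ratio `2` between outer and inner radius is what almost everywhere convergence of the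
  -- mollifications needs.
  let b : ℕ → ContDiffBump (0 : ℂ) := fun n =>
    ⟨δ / (n + 1) / 2, δ / (n + 1), by positivity, by
      have : 0 < δ / (n + 1) := by positivity
      linarith⟩
  let ρ : ℕ → ℂ → ℝ := fun n => (b n).normed volume
  have hρ : ∀ n, ContDiff ℝ ∞ (ρ n) := fun n => (b n).contDiff_normed
  have hρc : ∀ n, HasCompactSupport (ρ n) := fun n => (b n).hasCompactSupport_normed
  have hrOut : ∀ n, (b n).rOut ≤ δ := fun n =>
    div_le_self hδ0.le (by simp)
  have hsupp : ∀ n, ∀ x ∈ Metric.ball (0 : ℂ) R, ∀ t, x - t ∈ tsupport (ρ n) → t ∈ S := by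
    intro n x hx t ht
    rw [(b n).tsupport_normed_eq, mem_closedBall_zero_iff] at ht
    rw [mem_ball_zero_iff] at hx
    rw [hSdef, mem_closedBall_zero_iff]
    have h1 := norm_sub_le x (x - t)
    rw [sub_sub_cancel] at h1
    linarith [hrOut n]
  obtain ⟨g', hg'm, hgg'⟩ : AEStronglyMeasurable g (volume.restrict unitDisc) :=
    h.2.1.aestronglyMeasurable
  set k := unitDisc.indicator (fun z => ‖g' z‖ₑ) with hk
  have hkm : Measurable k := hg'm.measurable.enorm.indicator hD
  have hρm : ∀ n, Measurable fun y => ENNReal.ofReal (ρ n y) := fun n =>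
    (hρ n).continuous.measurable.ennreal_ofReal
  have hρ1 : ∀ n, ∫⁻ y, ENNReal.ofReal (ρ n y) ^ (1 : ℝ) = 1 := by
    intro n
    simp only [ENNReal.rpow_one]
    rw [← ofReal_integral_eq_lintegral_ofReal (b n).integrable_normed
      (Filter.Eventually.of_forall fun x => (b n).nonneg_normed x), (b n).integral_normed,
      ENNReal.ofReal_one]
  refine ⟨fun n => convolution (ρ n) (S.indicator f) (ContinuousLinearMap.lsmul ℝ ℝ), fun n => ?_,
    ?_, fun n => ?_⟩
  · exact (hρc n).contDiff_convolution_left _ ((hρ n).of_le (by norm_cast)) hloc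
  · have h1 : Filter.Tendsto (fun n => (b n).rOut) Filter.atTop (nhds 0) := by
      simpa [b, div_eq_mul_inv] using
        (tendsto_one_div_add_atTop_nhds_zero_nat (𝕜 := ℝ)).const_mul δ
    have h2 := ContDiffBump.ae_convolution_tendsto_right_of_locallyIntegrable (μ := volume)
      (K := 2) h1 (Filter.Eventually.of_forall fun n => by
        change δ / (n + 1) ≤ 2 * (δ / (n + 1) / 2); linarith) hloc
    filter_upwards [ae_restrict_of_ae h2, ae_restrict_mem measurableSet_ball] with z hz hzR
    have hzS : z ∈ S := Metric.ball_subset_closedBall (Metric.ball_subset_ball (by linarith) hzR)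
    rwa [indicator_of_mem hzS] at hz
  · have hpt : ∀ x ∈ Metric.ball (0 : ℂ) R, ‖fderiv ℝ (convolution (ρ n) (S.indicator f)
        (ContinuousLinearMap.lsmul ℝ ℝ)) x‖ₑ ≤ ∫⁻ z, k z * ENNReal.ofReal (ρ n (x - z)) := by
      intro x hx
      refine ContinuousLinearMap.opENorm_le_bound _ fun v => ?_
      rw [h.fderiv_convolution_apply hD hS hSD hfS (hρ n) (hρc n) (hsupp n x hx) v]
      calc _ ≤ ∫⁻ t in unitDisc, ‖inner ℝ (g t) v * ρ n (x - t)‖ₑ :=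
            enorm_integral_le_lintegral_enorm _
        _ ≤ ∫⁻ t in unitDisc, ‖g' t‖ₑ * ENNReal.ofReal (ρ n (x - t)) * ‖v‖ₑ := by
            refine lintegral_mono_ae ?_
            filter_upwards [hgg'] with t ht
            rw [enorm_mul, Real.enorm_of_nonneg ((b n).nonneg_normed _), ← ht, mul_right_comm]
            gcongr
            rw [← ofReal_norm, ← ofReal_norm, ← ofReal_norm, ← ENNReal.ofReal_mul (norm_nonneg _)]
            exact ENNReal.ofReal_le_ofReal (norm_inner_le_norm _ _)
        _ = _ := by
            rw [lintegral_mul_const' _ _ enorm_ne_top, ← lintegral_indicator hD]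
            congr 1
            refine lintegral_congr fun t => ?_
            by_cases ht : t ∈ unitDisc <;> simp [hk, ht]
    have hy := lintegral_rpow_lintegral_mul_sub_le hkm (hρm n) hq le_rfl one_pos (by ring)
    have hq0 : 0 < q := by linarith
    rw [hρ1, ENNReal.one_rpow, one_mul, div_self hq0.ne', ENNReal.rpow_one] at hy
    calc _ ≤ ∫⁻ x in Metric.ball (0 : ℂ) R, (∫⁻ z, k z * ENNReal.ofReal (ρ n (x - z))) ^ q :=
          setLIntegral_mono' measurableSet_ball fun x hx =>
            ENNReal.rpow_le_rpow (hpt x hx) hq0.le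
      _ ≤ ∫⁻ z, k z ^ q := (setLIntegral_le_lintegral _ _).trans hy
      _ = ∫⁻ z in unitDisc, ‖g' z‖ₑ ^ q := by
          rw [← lintegral_indicator hD]
          refine lintegral_congr fun t => ?_
          by_cases ht : t ∈ unitDisc <;> simp [hk, ht, hq0]
      _ = _ := by
          refine lintegral_congr_ae ?_
          filter_upwards [hgg'] with t ht
          rw [ht]

/-- A Sobolev–Poincaré inequality on the unit disc for functions with a weak gradient. The
function is not assumed to be integrable. -/
theorem exists_lintegral_enorm_sub_rpow_le {q r : ℝ} (hq : 1 ≤ q) (hqr : q ≤ r)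
    (hr : 1 / q - 1 / 2 < 1 / r) :
    ∃ C : ℝ≥0∞, C ≠ ⊤ ∧ ∀ (f : ℂ → ℝ) (g : ℂ → ℂ), HasWeakGradient unitDisc f g →
      ∫⁻ p, ‖f p.1 - f p.2‖ₑ ^ r ∂((volume.restrict unitDisc).prod (volume.restrict unitDisc)) ≤
      C * (∫⁻ z in unitDisc, ‖g z‖ₑ ^ q) ^ (r / q) := by
  obtain ⟨C, hC, hF⟩ := exists_lintegral_enorm_sub_rpow_le_of_contDiff hq hqr hr
  have hr0 : 0 < r := by linarith
  refine ⟨C, hC, fun f g h => ?_⟩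
  have hball : ∀ R : ℝ, 1 / 2 ≤ R → R < 1 →
      ∫⁻ p, ‖f p.1 - f p.2‖ₑ ^ r ∂((volume.restrict (Metric.ball (0 : ℂ) R)).prod
        (volume.restrict (Metric.ball (0 : ℂ) R))) ≤
      C * (∫⁻ z in unitDisc, ‖g z‖ₑ ^ q) ^ (r / q) := by
    intro R hR1 hR2
    obtain ⟨F, hFs, hFt, hFq⟩ := h.exists_contDiff_approx hR2 hq
    have hx := (Measure.quasiMeasurePreserving_fst (μ := volume.restrict (Metric.ball (0 : ℂ) R))
      (ν := volume.restrict (Metric.ball (0 : ℂ) R))).ae hFt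
    have hy := (Measure.quasiMeasurePreserving_snd (μ := volume.restrict (Metric.ball (0 : ℂ) R))
      (ν := volume.restrict (Metric.ball (0 : ℂ) R))).ae hFt
    -- Fatou's lemma along the smooth approximations.
    calc _ = ∫⁻ p, Filter.liminf (fun n => ‖F n p.1 - F n p.2‖ₑ ^ r) Filter.atTop
          ∂((volume.restrict (Metric.ball (0 : ℂ) R)).prod
            (volume.restrict (Metric.ball (0 : ℂ) R))) := by
          refine lintegral_congr_ae ?_
          filter_upwards [hx, hy] with p hp1 hp2
          exact ((hp1.sub hp2).enorm.ennrpow_const r).liminf_eq.symm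
      _ ≤ Filter.liminf (fun n => ∫⁻ p, ‖F n p.1 - F n p.2‖ₑ ^ r
          ∂((volume.restrict (Metric.ball (0 : ℂ) R)).prod
            (volume.restrict (Metric.ball (0 : ℂ) R)))) Filter.atTop := by
          refine lintegral_liminf_le fun n => ?_
          have := (hFs n).continuous.measurable
          exact ((this.comp measurable_fst).sub (this.comp measurable_snd)).enorm.pow_const r
      _ ≤ Filter.liminf (fun _ : ℕ => C * (∫⁻ z in unitDisc, ‖g z‖ₑ ^ q) ^ (r / q))
          Filter.atTop := by
          refine Filter.liminf_le_liminf (Filter.Eventually.of_forall fun n => ?_)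
          refine (hF _ (hFs n) R hR1 hR2.le).trans ?_
          exact mul_le_mul' le_rfl (ENNReal.rpow_le_rpow (hFq n) (by positivity))
      _ = _ := Filter.liminf_const _
  simp only [Measure.prod_restrict] at hball ⊢
  -- The shift by `2` keeps every radius at least `1/2`.
  let R : ℕ → ℝ := fun n => 1 - 1 / ((n : ℝ) + 2)
  have hRm : Monotone R := fun m n hmn => by
    have : (m : ℝ) ≤ n := by exact_mod_cast hmn
    simp only [R]
    gcongr
  have hmono : Monotone fun n => Metric.ball (0 : ℂ) (R n) ×ˢ Metric.ball (0 : ℂ) (R n) :=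
    fun m n hmn => prod_mono (Metric.ball_subset_ball (hRm hmn)) (Metric.ball_subset_ball (hRm hmn))
  have hU : unitDisc ×ˢ unitDisc = ⋃ n, Metric.ball (0 : ℂ) (R n) ×ˢ Metric.ball (0 : ℂ) (R n) := by
    have hlim : Filter.Tendsto R Filter.atTop (nhds 1) := by
      have h1 : Filter.Tendsto (fun n : ℕ => (n : ℝ) + 2) Filter.atTop Filter.atTop :=
        Filter.tendsto_atTop_add_const_right _ _ tendsto_natCast_atTop_atTop
      simpa [R] using (h1.inv_tendsto_atTop).const_sub 1
    ext ⟨x, y⟩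
    simp only [unitDisc, mem_prod, mem_ball_zero_iff, mem_iUnion]
    constructor
    · rintro ⟨hx, hy⟩
      obtain ⟨n, hn⟩ := ((hlim.eventually (lt_mem_nhds hx)).and
        (hlim.eventually (lt_mem_nhds hy))).exists
      exact ⟨n, hn⟩
    · rintro ⟨n, hx, hy⟩
      have : R n < 1 := by simp only [R]; linarith [show (0 : ℝ) < 1 / ((n : ℝ) + 2) by positivity]
      exact ⟨hx.trans this, hy.trans this⟩
  rw [hU, setLIntegral_iUnion_of_directed _ hmono.directed_le]
  refine iSup_le fun n => hball _ ?_ ?_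
  · have : 1 / ((n : ℝ) + 2) ≤ 1 / 2 := by gcongr; linarith [n.cast_nonneg (α := ℝ)]
    simp only [R]
    linarith
  · simp only [R]
    linarith [show (0 : ℝ) < 1 / ((n : ℝ) + 2) by positivity]

theorem isOpen_unitDisc : IsOpen unitDisc := Metric.isOpen_ball

theorem measurableSet_unitDisc : MeasurableSet unitDisc := measurableSet_ball

theorem volume_unitDisc_ne_top : volume unitDisc ≠ ⊤ := measure_ball_lt_top.ne

theorem volume_unitDisc_ne_zero : volume unitDisc ≠ 0 :=
  (Metric.measure_ball_pos volume _ one_pos).ne'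

instance isFiniteMeasure_restrict_unitDisc : IsFiniteMeasure (volume.restrict unitDisc) :=
  ⟨by rw [Measure.restrict_apply_univ]; exact volume_unitDisc_ne_top.lt_top⟩

theorem eLpNorm_ofReal_eq {E : Type*} [NormedAddCommGroup E] {μ : Measure ℂ} {r : ℝ} (hr : 0 < r)
    (f : ℂ → E) :
    eLpNorm f (ENNReal.ofReal r) μ = (∫⁻ z, ‖f z‖ₑ ^ r ∂μ) ^ (1 / r) := by
  rw [eLpNorm_eq_lintegral_rpow_enorm_toReal (by simpa using hr) ENNReal.ofReal_ne_top,
    ENNReal.toReal_ofReal hr.le]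

theorem eLpNorm_ofReal_rpow {E : Type*} [NormedAddCommGroup E] {μ : Measure ℂ} {r : ℝ}
    (hr : 0 < r) (f : ℂ → E) (p : ℝ) :
    eLpNorm f (ENNReal.ofReal r) μ ^ p = (∫⁻ z, ‖f z‖ₑ ^ r ∂μ) ^ (p / r) := by
  rw [eLpNorm_ofReal_eq hr, ← ENNReal.rpow_mul, one_div_mul_eq_div]

theorem lintegral_rpow_lt_top_of_memLp {E : Type*} [NormedAddCommGroup E] {μ : Measure ℂ} {r : ℝ}
    (hr : 0 < r) {f : ℂ → E} (hf : MemLp f (ENNReal.ofReal r) μ) :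
    ∫⁻ z, ‖f z‖ₑ ^ r ∂μ < ⊤ := by
  have := lintegral_rpow_enorm_lt_top_of_eLpNorm_lt_top (by simpa using hr) ENNReal.ofReal_ne_top
    hf.2
  rwa [ENNReal.toReal_ofReal hr.le] at this

/-! ### The Poincaré–Sobolev constant of the disc -/

/-- A function on the disc with a weak gradient in `L^q` is in `L^q`. -/
theorem HasWeakGradient.memLp {f : ℂ → ℝ} {g : ℂ → ℂ} {q : ℝ} (h : HasWeakGradient unitDisc f g)
    (hq : 1 ≤ q) (hg : ∫⁻ z in unitDisc, ‖g z‖ₑ ^ q < ⊤) :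
    MemLp f (ENNReal.ofReal q) (volume.restrict unitDisc) := by
  have hq0 : 0 < q := by linarith
  obtain ⟨C, hC, hf⟩ := exists_lintegral_enorm_sub_rpow_le hq le_rfl (by linarith)
  have hfm : AEStronglyMeasurable f (volume.restrict unitDisc) := h.1.aestronglyMeasurable
  have hm : AEMeasurable (fun p : ℂ × ℂ => ‖f p.1 - f p.2‖ₑ ^ q)
      ((volume.restrict unitDisc).prod (volume.restrict unitDisc)) :=
    (hfm.comp_fst.sub hfm.comp_snd).enorm.pow_const q
  have hfin := (hf f g h).trans_lt
    (ENNReal.mul_lt_top hC.lt_top (ENNReal.rpow_lt_top_of_nonneg (by positivity) hg.ne))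
  rw [lintegral_prod _ hm] at hfin
  have hae := ae_lt_top' hm.lintegral_prod_right' hfin.ne
  have : (ae (volume.restrict unitDisc)).NeBot := by
    rw [ae_neBot, Ne, Measure.restrict_eq_zero]
    exact volume_unitDisc_ne_zero
  -- By Fubini some `x` makes `y ↦ f x - f y` a function in `L^q`; the constant `f x` is in `L^q`
  -- too.
  obtain ⟨x, hx⟩ := hae.exists
  have h1 : MemLp (fun y => f x - f y) (ENNReal.ofReal q) (volume.restrict unitDisc) := by
    refine ⟨aestronglyMeasurable_const.sub hfm, ?_⟩
    rw [eLpNorm_ofReal_eq hq0]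
    exact ENNReal.rpow_lt_top_of_nonneg (by positivity) hx.ne
  have h2 := (memLp_const (f x)).sub h1
  rwa [show ((fun _ => f x) - fun y => f x - f y) = f by ext; simp] at h2

/-- The infimum over `c` is at most the value at `c = f x`; averaging over `x` turns the double
integral estimate into the one with an infimum. -/
theorem poincareSobolevConst_unitDisc_lt_top {q r : ℝ} (hq : 1 ≤ q) (hqr : q ≤ r)
    (hr : 1 / q - 1 / 2 < 1 / r) : poincareSobolevConst unitDisc r q < ⊤ := by
  have hq0 : 0 < q := by linarith
  have hr0 : 0 < r := by linarith
  obtain ⟨C, hC, hf⟩ := exists_lintegral_enorm_sub_rpow_le hq hqr hr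
  refine (sInf_le (a := (C / volume unitDisc) ^ (1 / r)) ?_).trans_lt
    (ENNReal.rpow_lt_top_of_nonneg (by positivity)
      (ENNReal.div_ne_top hC volume_unitDisc_ne_zero))
  intro f g h
  have hfm : AEStronglyMeasurable f (volume.restrict unitDisc) := h.1.1.aestronglyMeasurable
  have hm : AEMeasurable (fun p : ℂ × ℂ => ‖f p.1 - f p.2‖ₑ ^ r)
      ((volume.restrict unitDisc).prod (volume.restrict unitDisc)) :=
    (hfm.comp_fst.sub hfm.comp_snd).enorm.pow_const r
  have h1 := hf f g h.1
  rw [lintegral_prod _ hm] at h1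
  set X := ⨅ c : ℝ, eLpNorm (fun z => f z - c) (ENNReal.ofReal r) (volume.restrict unitDisc)
  have h2 : X ^ r * volume unitDisc ≤ C * (∫⁻ z in unitDisc, ‖g z‖ₑ ^ q) ^ (r / q) := by
    refine le_trans ?_ h1
    rw [← Measure.restrict_apply_univ, ← lintegral_const]
    refine lintegral_mono fun x => ?_
    calc X ^ r ≤ eLpNorm (fun z => f z - f x) (ENNReal.ofReal r) (volume.restrict unitDisc) ^ r :=
          ENNReal.rpow_le_rpow (iInf_le _ _) hr0.le
      _ = _ := by
          rw [eLpNorm_ofReal_rpow hr0, div_self hr0.ne', ENNReal.rpow_one]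
          refine lintegral_congr fun y => ?_
          rw [← enorm_neg, neg_sub]
  rw [← ENNReal.le_div_iff_mul_le (Or.inl volume_unitDisc_ne_zero)
    (Or.inl volume_unitDisc_ne_top), ENNReal.mul_div_right_comm] at h2
  have h3 := ENNReal.rpow_le_rpow h2 (z := 1 / r) (by positivity)
  rwa [← ENNReal.rpow_mul, mul_one_div_cancel hr0.ne', ENNReal.rpow_one,
    ENNReal.mul_rpow_of_nonneg _ _ (by positivity), ← ENNReal.rpow_mul,
    show r / q * (1 / r) = 1 / q by field_simp, ← eLpNorm_ofReal_eq hq0] at h3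

/-- The infimum in the definition is itself admissible, by division by the gradient norm. If that
norm vanishes, any admissible constant gives the claim, and one exists by finiteness. -/
theorem iInf_eLpNorm_sub_le_poincareSobolevConst {Ω : Set ℂ} {f : ℂ → ℝ} {g : ℂ → ℂ} {r q : ℝ}
    (h : MemW Ω q f g) (hB : poincareSobolevConst Ω r q ≠ ⊤) :
    (⨅ c : ℝ, eLpNorm (fun z => f z - c) (ENNReal.ofReal r) (volume.restrict Ω)) ≤
      poincareSobolevConst Ω r q * eLpNorm g (ENNReal.ofReal q) (volume.restrict Ω) := by
  by_cases h0 : eLpNorm g (ENNReal.ofReal q) (volume.restrict Ω) = 0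
  · obtain ⟨B, hBmem, -⟩ := sInf_lt_iff.1 hB.lt_top
    have := hBmem f g h
    rw [h0, mul_zero] at this ⊢
    exact this
  · rw [← ENNReal.div_le_iff h0 h.2.2.2.ne]
    exact le_sInf fun B hBmem => (ENNReal.div_le_iff h0 h.2.2.2.ne).2 (hBmem f g h)

theorem hasWeakGradient_of_contDiff {U : Set ℂ} {F : ℂ → ℝ} {G : ℂ → ℂ}
    (hF : ContDiff ℝ 1 F) (hG : Continuous G) (hFG : ∀ z v, fderiv ℝ F z v = inner ℝ (G z) v) :
    HasWeakGradient U F G := by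
  refine ⟨hF.continuous.locallyIntegrable.locallyIntegrableOn _,
    hG.locallyIntegrable.locallyIntegrableOn _, fun η hη hηc hηU v => ?_⟩
  have hη0 : ∀ z ∉ U, η z = 0 := fun z hz => image_eq_zero_of_notMem_tsupport fun h => hz (hηU h)
  have hη0' : ∀ z ∉ U, fderiv ℝ η z v = 0 := fun z hz => by
    rw [fderiv_of_notMem_tsupport ℝ fun h => hz (hηU h)]
    rfl
  have hcd : Continuous fun z => fderiv ℝ η z v :=
    (hη.continuous_fderiv (by simp)).clm_apply continuous_const
  have hcF : Continuous fun z => fderiv ℝ F z v :=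
    (hF.continuous_fderiv (by simp)).clm_apply continuous_const
  have hηcd : HasCompactSupport fun z => fderiv ℝ η z v := hηc.fderiv_apply ℝ v
  rw [setIntegral_eq_integral_of_forall_compl_eq_zero fun z hz => by rw [hη0' z hz, mul_zero],
    setIntegral_eq_integral_of_forall_compl_eq_zero fun z hz => by rw [hη0 z hz, mul_zero],
    integral_mul_fderiv_eq_neg_fderiv_mul_of_integrable]
  · simp only [hFG]
  · exact (hcF.mul hη.continuous).integrable_of_hasCompactSupport hηc.mul_left
  · exact (hF.continuous.mul hcd).integrable_of_hasCompactSupport hηcd.mul_left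
  · exact (hF.continuous.mul hη.continuous).integrable_of_hasCompactSupport hηc.mul_left
  · exact fun z _ => hF.differentiable (by simp) z
  · exact fun z _ => hη.differentiable (by simp) z

/-- Tested on `Re z`: by oddness `2 Re z` is the difference of `Re z - c` and its reflection, so no
constant `c` makes the norm small. This rules out a product `0 · ∞` in `conformalBound`. -/
theorem poincareSobolevConst_unitDisc_ne_zero {q r : ℝ} (hr : 1 ≤ r) :
    poincareSobolevConst unitDisc r q ≠ 0 := by
  intro h0
  have hgrad : HasWeakGradient unitDisc Complex.re (fun _ => 1) := by
    refine hasWeakGradient_of_contDiff Complex.reCLM.contDiff continuous_const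
      fun z v => ?_
    rw [show Complex.re = Complex.reCLM from rfl, ContinuousLinearMap.fderiv]
    simp [Complex.inner]
  have hLp : ∀ s : ℝ≥0∞, MemLp Complex.re s (volume.restrict unitDisc) := fun s => by
    refine MemLp.of_bound Complex.measurable_re.aestronglyMeasurable 1 ?_
    filter_upwards [ae_restrict_mem measurableSet_unitDisc] with z hz
    exact (Complex.abs_re_le_norm z).trans (by simpa using (mem_ball_zero_iff.1 hz).le)
  have hW : MemW unitDisc q Complex.re (fun _ => 1) := ⟨hgrad, hLp _, memLp_const _⟩
  have h1 := iInf_eLpNorm_sub_le_poincareSobolevConst (r := r) hW (by simp [h0])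
  rw [h0, zero_mul] at h1
  have hneg : MeasurePreserving (fun z : ℂ => -z) (volume.restrict unitDisc)
      (volume.restrict unitDisc) := by
    have := (Measure.measurePreserving_neg (volume : Measure ℂ)).restrict_preimage
      measurableSet_unitDisc
    rwa [show Neg.neg ⁻¹' unitDisc = unitDisc by ext; simp [unitDisc]] at this
  have h2 : ∀ c : ℝ, eLpNorm (fun z : ℂ => 2 * z.re) (ENNReal.ofReal r)
      (volume.restrict unitDisc) ≤
        2 * eLpNorm (fun z : ℂ => z.re - c) (ENNReal.ofReal r) (volume.restrict unitDisc) := by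
    intro c
    have hm : AEStronglyMeasurable (fun z : ℂ => z.re - c) (volume.restrict unitDisc) :=
      (Complex.measurable_re.sub_const c).aestronglyMeasurable
    have h3 := eLpNorm_comp_measurePreserving (p := ENNReal.ofReal r) hm hneg
    calc _ = eLpNorm ((fun z : ℂ => z.re - c) - (fun z : ℂ => z.re - c) ∘ fun z => -z)
          (ENNReal.ofReal r) (volume.restrict unitDisc) := by
          congr 1
          ext z
          simp
          ring
      _ ≤ _ := by
          refine (eLpNorm_sub_le hm (hm.comp_measurePreserving hneg) (by simpa using hr)).trans_eq ?_
          rw [h3, two_mul]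
  have h3 : eLpNorm (fun z : ℂ => 2 * z.re) (ENNReal.ofReal r) (volume.restrict unitDisc) = 0 := by
    have := le_iInf h2
    rw [← ENNReal.mul_iInf_of_ne (by simp) (by simp), nonpos_iff_eq_zero.1 h1, mul_zero] at this
    exact nonpos_iff_eq_zero.1 this
  rw [eLpNorm_eq_zero_iff (by fun_prop) (by simp; linarith)] at h3
  have h4 := Measure.eqOn_open_of_ae_eq h3 isOpen_unitDisc (by fun_prop) continuousOn_const
  have h5 := h4 (show ((1 / 2 : ℝ) : ℂ) ∈ unitDisc by simp [unitDisc]; norm_num)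
  simp at h5

/-! ### The zero mean condition -/

/-- The graph of the convex function `|·|^p` lies above its tangent at `a`; Young's inequality for
products proves it without derivatives. -/
theorem abs_rpow_sub_mul_le_abs_sub_rpow {p : ℝ} (hp : 1 < p) (a c : ℝ) :
    |a| ^ p - p * c * (|a| ^ (p - 2) * a) ≤ |a - c| ^ p := by
  have hp0 : 0 < p := by linarith
  have hsq : |a| ^ (p - 2) * a * a = |a| ^ p := by
    rcases eq_or_ne a 0 with rfl | ha
    · simp [hp0.ne']
    · rw [mul_assoc, ← abs_mul_abs_self a, ← mul_assoc, ← Real.rpow_add_one (abs_ne_zero.2 ha),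
        ← Real.rpow_add_one (abs_ne_zero.2 ha)]
      ring_nf
  have hle : |a| ^ (p - 2) * a * (a - c) ≤ |a| ^ (p - 1) * |a - c| := by
    rcases eq_or_ne a 0 with rfl | ha
    · simp
      positivity
    · refine (le_abs_self _).trans_eq ?_
      rw [abs_mul, abs_mul, abs_of_nonneg (Real.rpow_nonneg (abs_nonneg a) _),
        ← Real.rpow_add_one (abs_ne_zero.2 ha)]
      ring_nf
  have hy := Real.young_inequality_of_nonneg (Real.rpow_nonneg (abs_nonneg a) (p - 1))
    (abs_nonneg (a - c)) (Real.HolderConjugate.conjExponent hp).symm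
  rw [← Real.rpow_mul (abs_nonneg a), Real.conjExponent,
    show (p - 1) * (p / (p - 1)) = p by field_simp [show p - 1 ≠ 0 by linarith]] at hy
  have h1 : p * (|a| ^ (p - 1) * |a - c|) ≤ (p - 1) * |a| ^ p + |a - c| ^ p := by
    have := mul_le_mul_of_nonneg_left hy hp0.le
    refine this.trans_eq ?_
    field_simp
  nlinarith [mul_le_mul_of_nonneg_left hle hp0.le]

/-- Integrating the tangent line inequality, the linear term vanishes by `h0`. Finiteness of the
measure makes `|u|^{p-1}` integrable. -/
theorem lintegral_enorm_rpow_le_of_integral_eq_zero {μ : Measure ℂ} [IsFiniteMeasure μ] {p : ℝ}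
    (hp : 1 < p) {u : ℂ → ℝ} (hu : MemLp u (ENNReal.ofReal p) μ)
    (h0 : ∫ z, |u z| ^ (p - 2) * u z ∂μ = 0) (c : ℝ) :
    ∫⁻ z, ‖u z‖ₑ ^ p ∂μ ≤ ∫⁻ z, ‖u z - c‖ₑ ^ p ∂μ := by
  have hp0 : 0 < p := by linarith
  have hI : ∀ {w : ℂ → ℝ}, MemLp w (ENNReal.ofReal p) μ → Integrable (fun z => |w z| ^ p) μ := by
    intro w hw
    have := hw.integrable_norm_rpow (by simpa using hp0) ENNReal.ofReal_ne_top
    simpa [ENNReal.toReal_ofReal hp0.le] using this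
  have hle : ∀ w : ℂ → ℝ, MemLp w (ENNReal.ofReal p) μ →
      ∫⁻ z, ‖w z‖ₑ ^ p ∂μ = ENNReal.ofReal (∫ z, |w z| ^ p ∂μ) := by
    intro w hw
    rw [ofReal_integral_eq_lintegral_ofReal (hI hw)
      (Filter.Eventually.of_forall fun z => by positivity)]
    refine lintegral_congr fun z => ?_
    rw [← ENNReal.ofReal_rpow_of_nonneg (abs_nonneg _) hp0.le, ← Real.norm_eq_abs, ofReal_norm]
  have huc : MemLp (fun z => u z - c) (ENNReal.ofReal p) μ := hu.sub (memLp_const c)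
  have hJ : Integrable (fun z => |u z| ^ (p - 2) * u z) μ := by
    refine ((integrable_const (1 : ℝ)).add (hI hu)).mono'
      (((hu.1.aemeasurable.abs.pow_const _).mul hu.1.aemeasurable).aestronglyMeasurable)
      (Filter.Eventually.of_forall fun z => ?_)
    rw [norm_mul, Real.norm_of_nonneg (by positivity), Real.norm_eq_abs]
    rcases eq_or_ne (u z) 0 with hz | hz
    · simp [hz]
      positivity
    · have hpos := abs_pos.2 hz
      rw [← Real.rpow_add_one hpos.ne', show p - 2 + 1 = p - 1 by ring]
      rcases le_total |u z| 1 with h1 | h1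
      · have := Real.rpow_le_one hpos.le h1 (show 0 ≤ p - 1 by linarith)
        have := Real.rpow_nonneg hpos.le p
        simp only [Pi.add_apply]
        linarith
      · have := Real.rpow_le_rpow_of_exponent_le h1 (show p - 1 ≤ p by linarith)
        simp only [Pi.add_apply]
        linarith
  rw [hle u hu, hle _ huc]
  refine ENNReal.ofReal_le_ofReal ?_
  have h1 : ∫ z, (|u z| ^ p - p * c * (|u z| ^ (p - 2) * u z)) ∂μ ≤ ∫ z, |u z - c| ^ p ∂μ :=
    integral_mono ((hI hu).sub (hJ.const_mul _)) (hI huc)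
      fun z => abs_rpow_sub_mul_le_abs_sub_rpow hp _ _
  rwa [integral_sub (hI hu) (hJ.const_mul _), integral_const_mul, h0, mul_zero, sub_zero] at h1

/-! ### Transfer of the Poincaré–Sobolev inequality from the disc to `Ω`. -/

namespace IsBiholomorphic

variable {Ω : Set ℂ} {ψ φ : ℂ → ℂ}

theorem aemeasurable_enorm_deriv (h : IsBiholomorphic unitDisc Ω ψ φ) :
    AEMeasurable (fun w => ‖deriv ψ w‖ₑ) (volume.restrict unitDisc) :=
  (h.continuousOn_deriv.aestronglyMeasurable measurableSet_unitDisc).enorm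

theorem lintegral_enorm_deriv_rpow_ne_zero (h : IsBiholomorphic unitDisc Ω ψ φ) (β : ℝ) :
    ∫⁻ w in unitDisc, ‖deriv ψ w‖ₑ ^ β ≠ 0 := by
  rw [Ne, lintegral_eq_zero_iff' (h.aemeasurable_enorm_deriv.pow_const β)]
  intro h0
  have : (ae (volume.restrict unitDisc)).NeBot := by
    rw [ae_neBot, Ne, Measure.restrict_eq_zero]
    exact volume_unitDisc_ne_zero
  obtain ⟨w, hw, hw'⟩ := (h0.and (ae_restrict_mem measurableSet_unitDisc)).exists
  have h1 : ‖deriv ψ w‖ₑ ≠ 0 := by simpa using h.deriv_ne_zero hw'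
  exact (ENNReal.rpow_pos (pos_iff_ne_zero.2 h1) enorm_ne_top).ne' hw

theorem volume_lt_top (h : IsBiholomorphic unitDisc Ω ψ φ) {α : ℝ} (hα : 2 < α)
    (hfin : ∫⁻ w in unitDisc, ‖deriv ψ w‖ₑ ^ α < ⊤) : volume Ω < ⊤ := by
  have h1 := h.setLIntegral_eq fun _ => 1
  rw [setLIntegral_one] at h1
  simp only [mul_one] at h1
  rw [h1]
  calc ∫⁻ w in unitDisc, ‖deriv ψ w‖ₑ ^ (2 : ℝ) ≤ ∫⁻ w in unitDisc, (1 + ‖deriv ψ w‖ₑ ^ α) := by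
        refine lintegral_mono fun w => ?_
        rcases le_total ‖deriv ψ w‖ₑ 1 with h2 | h2
        · exact (ENNReal.rpow_le_one h2 (by norm_num)).trans le_self_add
        · exact (ENNReal.rpow_le_rpow_of_exponent_le h2 hα.le).trans le_add_self
    _ = volume unitDisc + ∫⁻ w in unitDisc, ‖deriv ψ w‖ₑ ^ α := by
        rw [lintegral_add_left measurable_const, setLIntegral_one]
    _ < ⊤ := ENNReal.add_lt_top.2 ⟨volume_unitDisc_ne_top.lt_top, hfin⟩

/-- The composition operator `L^{1,p}(Ω) → L^{1,q}(𝔻)` is bounded. -/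
theorem lintegral_enorm_grad_comp_rpow_le (h : IsBiholomorphic unitDisc Ω ψ φ) {p q : ℝ}
    (hq : 0 < q) (hqp : q < p) {g : ℂ → ℂ} (hg : LocallyIntegrableOn g Ω) :
    ∫⁻ w in unitDisc, ‖(starRingEnd ℂ) (deriv ψ w) * g (ψ w)‖ₑ ^ q ≤
      (∫⁻ z in Ω, ‖g z‖ₑ ^ p) ^ (q / p) *
        (∫⁻ w in unitDisc, ‖deriv ψ w‖ₑ ^ ((p - 2) * q / (p - q))) ^ ((p - q) / p) := by
  have hp : 0 < p := hq.trans hqp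
  have hpq : 0 < p - q := sub_pos.2 hqp
  have hgm : AEMeasurable (fun w => ‖g (ψ w)‖ₑ) (volume.restrict unitDisc) :=
    (h.locallyIntegrableOn_comp hg).aestronglyMeasurable.enorm
  have hdm := h.aemeasurable_enorm_deriv
  -- Hölder for `|ψ'|^q |g|^q = (|ψ'|² |g|^p)^{q/p} · |ψ'|^{(p-2)q/p}`. The last exponent may be
  -- negative, so `ψ' ≠ 0` matters.
  have key := ENNReal.lintegral_mul_norm_pow_le (μ := volume.restrict unitDisc)
    ((hdm.pow_const (2 : ℝ)).mul (hgm.pow_const p))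
    (hdm.pow_const ((p - 2) * q / (p - q))) (show 0 ≤ q / p by positivity)
    (show 0 ≤ (p - q) / p by positivity) (by field_simp; ring)
  rw [h.setLIntegral_eq fun z => ‖g z‖ₑ ^ p]
  refine le_trans (setLIntegral_mono' measurableSet_unitDisc fun w hw => le_of_eq ?_) key
  have hd0 : ‖deriv ψ w‖ₑ ≠ 0 := by simpa using h.deriv_ne_zero hw
  rw [enorm_mul, RCLike.enorm_conj, ENNReal.mul_rpow_of_nonneg _ _ hq.le, Pi.mul_apply,
    ENNReal.mul_rpow_of_nonneg _ _ (by positivity), ← ENNReal.rpow_mul, ← ENNReal.rpow_mul,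
    ← ENNReal.rpow_mul, mul_right_comm, ← ENNReal.rpow_add _ _ hd0 enorm_ne_top,
    mul_div_cancel₀ _ hp.ne']
  congr 2
  field_simp
  ring

theorem lintegral_enorm_sub_rpow_le (h : IsBiholomorphic unitDisc Ω ψ φ) {α p : ℝ}
    (hα : 2 < α) (hp : 0 < p) {u : ℂ → ℝ} (hu : LocallyIntegrableOn u Ω) (c : ℝ) :
    ∫⁻ z in Ω, ‖u z - c‖ₑ ^ p ≤
      eLpNorm (deriv ψ) (ENNReal.ofReal α) (volume.restrict unitDisc) ^ (2 : ℝ) *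
        eLpNorm (fun w => u (ψ w) - c) (ENNReal.ofReal (α * p / (α - 2)))
          (volume.restrict unitDisc) ^ p := by
  have hα0 : 0 < α := by linarith
  have hα2 : 0 < α - 2 := by linarith
  have hr : 0 < α * p / (α - 2) := by positivity
  have hum : AEMeasurable (fun w => ‖u (ψ w) - c‖ₑ) (volume.restrict unitDisc) :=
    ((h.locallyIntegrableOn_comp hu).aestronglyMeasurable.sub
      aestronglyMeasurable_const).enorm
  have key := ENNReal.lintegral_mul_norm_pow_le (μ := volume.restrict unitDisc)
    (h.aemeasurable_enorm_deriv.pow_const α) (hum.pow_const (α * p / (α - 2)))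
    (show 0 ≤ 2 / α by positivity) (show 0 ≤ (α - 2) / α by positivity) (by field_simp; ring)
  rw [eLpNorm_ofReal_rpow hα0, eLpNorm_ofReal_rpow hr, h.setLIntegral_eq fun z => ‖u z - c‖ₑ ^ p]
  refine (lintegral_mono fun w => le_of_eq ?_).trans (key.trans_eq ?_)
  · rw [← ENNReal.rpow_mul, ← ENNReal.rpow_mul, mul_div_cancel₀ _ hα0.ne']
    congr 2
    field_simp
  · congr 2
    field_simp

/-- The Poincaré inequality in `Ω`, for functions of zero mean. -/
theorem lintegral_enorm_rpow_le (h : IsBiholomorphic unitDisc Ω ψ φ) {α p q : ℝ}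
    (hα : 2 < α) (hp : 1 < p) (hq : 1 ≤ q) (hqp : q < p)
    (hA : ∫⁻ w in unitDisc, ‖deriv ψ w‖ₑ ^ α < ⊤)
    (hN : ∫⁻ w in unitDisc, ‖deriv ψ w‖ₑ ^ ((p - 2) * q / (p - q)) < ⊤)
    (hB : poincareSobolevConst unitDisc (α * p / (α - 2)) q ≠ ⊤) {u : ℂ → ℝ} {g : ℂ → ℂ}
    (hu : MemW Ω p u g) (h0 : ∫ z in Ω, |u z| ^ (p - 2) * u z = 0) :
    ∫⁻ z in Ω, ‖u z‖ₑ ^ p ≤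
      eLpNorm (deriv ψ) (ENNReal.ofReal α) (volume.restrict unitDisc) ^ (2 : ℝ) *
        (∫⁻ w in unitDisc, ‖deriv ψ w‖ₑ ^ ((p - 2) * q / (p - q))) ^ ((p - q) / q) *
        poincareSobolevConst unitDisc (α * p / (α - 2)) q ^ p * ∫⁻ z in Ω, ‖g z‖ₑ ^ p := by
  have hp0 : 0 < p := by linarith
  have hq0 : 0 < q := by linarith
  have hα0 : 0 < α := by linarith
  have hpq : 0 < p - q := sub_pos.2 hqp
  have : IsFiniteMeasure (volume.restrict Ω) :=
    ⟨by rw [Measure.restrict_apply_univ]; exact h.volume_lt_top hα hA⟩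
  have hX := lintegral_rpow_lt_top_of_memLp hp0 hu.2.2
  have hgrad := h.lintegral_enorm_grad_comp_rpow_le hq0 hqp hu.1.2.1
  set f := fun w => u (ψ w)
  set G := fun w => (starRingEnd ℂ) (deriv ψ w) * g (ψ w)
  set N := ∫⁻ w in unitDisc, ‖deriv ψ w‖ₑ ^ ((p - 2) * q / (p - q))
  set X := ∫⁻ z in Ω, ‖g z‖ₑ ^ p
  set r := α * p / (α - 2)
  set B := poincareSobolevConst unitDisc r q
  have hfG : HasWeakGradient unitDisc f G := hu.1.comp h
  have hGfin : ∫⁻ w in unitDisc, ‖G w‖ₑ ^ q < ⊤ := hgrad.trans_lt <|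
    ENNReal.mul_lt_top (ENNReal.rpow_lt_top_of_nonneg (by positivity) hX.ne)
      (ENNReal.rpow_lt_top_of_nonneg (by positivity) hN.ne)
  have hW : MemW unitDisc q f G := by
    refine ⟨hfG, hfG.memLp hq hGfin, hfG.2.1.aestronglyMeasurable, ?_⟩
    rw [eLpNorm_ofReal_eq hq0]
    exact ENNReal.rpow_lt_top_of_nonneg (by positivity) hGfin.ne
  have hGp : eLpNorm G (ENNReal.ofReal q) (volume.restrict unitDisc) ^ p ≤
      X * N ^ ((p - q) / q) := by
    rw [eLpNorm_ofReal_rpow hq0]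
    refine (ENNReal.rpow_le_rpow hgrad (by positivity)).trans_eq ?_
    rw [ENNReal.mul_rpow_of_nonneg _ _ (by positivity), ← ENNReal.rpow_mul, ← ENNReal.rpow_mul,
      div_mul_div_cancel₀ hp0.ne', div_mul_div_cancel₀ hp0.ne', div_self hq0.ne', ENNReal.rpow_one]
  set A := eLpNorm (deriv ψ) (ENNReal.ofReal α) (volume.restrict unitDisc) ^ (2 : ℝ)
  have hA' : A = (∫⁻ w in unitDisc, ‖deriv ψ w‖ₑ ^ α) ^ (2 / α) := eLpNorm_ofReal_rpow hα0 _ _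
  have hAtop : A ^ (1 / p) ≠ ⊤ := by
    rw [hA']
    exact ENNReal.rpow_ne_top_of_nonneg (by positivity)
      (ENNReal.rpow_ne_top_of_nonneg (by positivity) hA.ne)
  -- A finite nonzero factor may be moved past the infimum over `c`.
  have hA0 : A ^ (1 / p) ≠ 0 := by
    have hpos := pos_iff_ne_zero.2 (h.lintegral_enorm_deriv_rpow_ne_zero α)
    rw [hA']
    exact (ENNReal.rpow_pos (ENNReal.rpow_pos hpos hA.ne)
      (ENNReal.rpow_ne_top_of_nonneg (by positivity) hA.ne)).ne'
  have h1 : (∫⁻ z in Ω, ‖u z‖ₑ ^ p) ^ (1 / p) ≤ A ^ (1 / p) *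
      ⨅ c : ℝ, eLpNorm (fun w => f w - c) (ENNReal.ofReal r) (volume.restrict unitDisc) := by
    rw [ENNReal.mul_iInf_of_ne hA0 hAtop]
    refine le_iInf fun c => ?_
    refine (ENNReal.rpow_le_rpow ((lintegral_enorm_rpow_le_of_integral_eq_zero hp hu.2.1 h0 c).trans
      (h.lintegral_enorm_sub_rpow_le hα hp0 hu.1.1 c)) (by positivity)).trans_eq ?_
    rw [ENNReal.mul_rpow_of_nonneg _ _ (by positivity), ← ENNReal.rpow_mul,
      ← ENNReal.rpow_mul _ p, mul_one_div_cancel hp0.ne', ENNReal.rpow_one]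
  have h2 := ENNReal.rpow_le_rpow (h1.trans (mul_le_mul' le_rfl
    (iInf_eLpNorm_sub_le_poincareSobolevConst hW hB))) hp0.le
  rw [ENNReal.mul_rpow_of_nonneg _ _ hp0.le, ENNReal.mul_rpow_of_nonneg _ _ hp0.le,
    ← ENNReal.rpow_mul, ← ENNReal.rpow_mul, one_div_mul_cancel hp0.ne', ENNReal.rpow_one,
    ENNReal.rpow_one] at h2
  calc _ ≤ A * (B ^ p * (X * N ^ ((p - q) / q))) := h2.trans (by gcongr)
    _ = _ := by ring

end IsBiholomorphic

/-! ### Bounds for the variational and the weak eigenvalues. -/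

theorem discMoment_lt_top_of_isConformalRegular {α : ℝ} {Ω : Set ℂ} {φ : ℂ → ℂ}
    (hΩ : IsConformalRegular α Ω) (hφ : IsConformalOntoDisc Ω φ) : discMoment Ω φ α < ⊤ := by
  obtain ⟨hα, hΩ', φ₁, hφ₁, hfin⟩ := hΩ
  exact setLIntegral_enorm_deriv_rpow_lt_top (hφ₁.isBiholomorphic hΩ') (hφ.isBiholomorphic hΩ')
    hα.le hfin

theorem two_mul_div_four_sub_lt {p : ℝ} (hp0 : 0 < p) (hp2 : p < 2) : 2 * p / (4 - p) < p := by
  rw [div_lt_iff₀ (by linarith)]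
  nlinarith

theorem inv_firstNeumannEigenvalue_le_conformalBound {α p : ℝ} {Ω : Set ℂ} {φ : ℂ → ℂ}
    (hΩ : IsConformalRegular α Ω) (hφ : IsConformalOntoDisc Ω φ) (hp : p ∈ Ioo (4 / 3 : ℝ) 2) :
    (firstNeumannEigenvalue Ω p)⁻¹ ≤ conformalBound Ω φ α p := by
  have hA := discMoment_lt_top_of_isConformalRegular hΩ hφ
  have h := hφ.isBiholomorphic hΩ.2.1
  have hα : 2 < α := hΩ.1
  have hp1 : 1 < p := by linarith [hp.1]
  have hp0 : 0 < p := by linarith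
  refine le_iInf₂ fun q hq => ?_
  have hq0 : 0 < q := by linarith [hq.1]
  have hqp : q < p := hq.2.trans (two_mul_div_four_sub_lt hp0 hp.2)
  have hpq : 0 < p - q := sub_pos.2 hqp
  have hr : 1 ≤ α * p / (α - 2) := by
    rw [le_div_iff₀ (by linarith)]
    nlinarith
  set T := eLpNorm (derivInv Ω φ) (ENNReal.ofReal α) (volume.restrict unitDisc) ^ (2 : ℝ) *
    discMoment Ω φ ((p - 2) * q / (p - q)) ^ ((p - q) / q) *
    poincareSobolevConst unitDisc (α * p / (α - 2)) q ^ p with hT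
  -- If `T` is finite, so are the moment and the Poincaré–Sobolev constant, because no factor is
  -- zero.
  rcases eq_or_ne T ⊤ with hTtop | hTtop
  · rw [hTtop]
    exact le_top
  have hA0 : eLpNorm (derivInv Ω φ) (ENNReal.ofReal α) (volume.restrict unitDisc) ^ (2 : ℝ) ≠ 0 := by
    rw [eLpNorm_ofReal_rpow (by linarith)]
    exact (ENNReal.rpow_pos (pos_iff_ne_zero.2 (h.lintegral_enorm_deriv_rpow_ne_zero α)) hA.ne).ne'
  have hB0 : poincareSobolevConst unitDisc (α * p / (α - 2)) q ≠ 0 :=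
    poincareSobolevConst_unitDisc_ne_zero hr
  have hN0 : discMoment Ω φ ((p - 2) * q / (p - q)) ≠ 0 := h.lintegral_enorm_deriv_rpow_ne_zero _
  have hN : discMoment Ω φ ((p - 2) * q / (p - q)) ≠ ⊤ := by
    intro hN
    refine hTtop ?_
    rw [hT, hN, ENNReal.top_rpow_of_pos (by positivity), ENNReal.mul_top hA0,
      ENNReal.top_mul]
    simp [ENNReal.rpow_eq_zero_iff, hB0, hp0.le]
  have hB : poincareSobolevConst unitDisc (α * p / (α - 2)) q ≠ ⊤ := by
    intro hB
    refine hTtop ?_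
    rw [hT, hB, ENNReal.top_rpow_of_pos hp0, ENNReal.mul_top]
    exact mul_ne_zero hA0 (ENNReal.rpow_pos (pos_iff_ne_zero.2 hN0) hN).ne'
  rw [ENNReal.inv_le_iff_inv_le]
  refine le_sInf ?_
  rintro m ⟨u, g, hu, hu0, hmean, rfl⟩
  have key : ∫⁻ z in Ω, ‖u z‖ₑ ^ p ≤ T * ∫⁻ z in Ω, ‖g z‖ₑ ^ p :=
    h.lintegral_enorm_rpow_le hα hp1 hq.1 hqp hA hN.lt_top hB hu hmean
  have hYtop := lintegral_rpow_lt_top_of_memLp hp0 hu.2.1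
  have hY0 : ∫⁻ z in Ω, ‖u z‖ₑ ^ p ≠ 0 := by
    rw [Ne, lintegral_eq_zero_iff' (hu.2.1.1.enorm.pow_const p)]
    refine fun h0 => hu0 ?_
    filter_upwards [h0] with z hz
    simpa [ENNReal.rpow_eq_zero_iff, hp0, hp0.not_gt] using hz
  rw [ENNReal.le_div_iff_mul_le (Or.inl hY0) (Or.inl hYtop.ne)]
  calc T⁻¹ * ∫⁻ z in Ω, ‖u z‖ₑ ^ p ≤ T⁻¹ * (T * ∫⁻ z in Ω, ‖g z‖ₑ ^ p) := by gcongr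
    _ = T⁻¹ * T * ∫⁻ z in Ω, ‖g z‖ₑ ^ p := (mul_assoc _ _ _).symm
    _ ≤ 1 * ∫⁻ z in Ω, ‖g z‖ₑ ^ p := by gcongr; exact ENNReal.inv_mul_le_one _
    _ = _ := one_mul _

theorem memW_const {Ω : Set ℂ} (hΩ : volume Ω < ⊤) (p c : ℝ) :
    MemW Ω p (fun _ => c) (fun _ => 0) := by
  have : IsFiniteMeasure (volume.restrict Ω) := ⟨by rwa [Measure.restrict_apply_univ]⟩
  exact ⟨hasWeakGradient_of_contDiff contDiff_const continuous_const fun z v => by simp,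
    memLp_const _, memLp_const _⟩

/-- A nonzero Neumann eigenvalue is positive, and at least the first one. -/
theorem IsNeumannEigenvalue.firstNeumannEigenvalue_le {Ω : Set ℂ} (hΩ : volume Ω < ⊤) {p m : ℝ}
    (hp : 1 < p) (hm : m ≠ 0) (h : IsNeumannEigenvalue Ω p m) :
    0 < m ∧ firstNeumannEigenvalue Ω p ≤ ENNReal.ofReal m := by
  have hp0 : 0 < p := by linarith
  obtain ⟨u, g, hu, hu0, hweak⟩ := h
  -- Constants are admissible test functions since `Ω` has finite area.
  have hmean : ∫ z in Ω, |u z| ^ (p - 2) * u z = 0 := by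
    have := hweak _ _ (memW_const hΩ p 1)
    simpa [hm] using this
  have hpow : ∀ {E : Type} [NormedAddCommGroup E] {w : ℂ → E},
      MemLp w (ENNReal.ofReal p) (volume.restrict Ω) →
      ∫⁻ z in Ω, ‖w z‖ₑ ^ p = ENNReal.ofReal (∫ z in Ω, ‖w z‖ ^ p) := by
    intro E _ w hw
    have hi := hw.integrable_norm_rpow (by simpa using hp0) ENNReal.ofReal_ne_top
    rw [ENNReal.toReal_ofReal hp0.le] at hi
    rw [ofReal_integral_eq_lintegral_ofReal hi
      (Filter.Eventually.of_forall fun z => by positivity)]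
    refine lintegral_congr fun z => ?_
    rw [← ENNReal.ofReal_rpow_of_nonneg (norm_nonneg _) hp0.le, ofReal_norm]
  have hself : ∀ a : ℝ, 0 ≤ a → a ^ (p - 2) * a ^ 2 = a ^ p := by
    intro a ha
    rcases ha.eq_or_lt with rfl | ha
    · simp [hp0.ne']
    · rw [← Real.rpow_natCast, ← Real.rpow_add ha]
      norm_num
  have heq : ∫ z in Ω, ‖g z‖ ^ p = m * ∫ z in Ω, ‖u z‖ ^ p := by
    have := hweak u g hu
    simp only [real_inner_self_eq_norm_sq, hself _ (norm_nonneg _), mul_assoc, ← pow_two] at this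
    rw [this]
    congr 1
    refine integral_congr_ae (Filter.Eventually.of_forall fun z => ?_)
    simp only
    rw [← sq_abs, hself _ (abs_nonneg _), Real.norm_eq_abs]
  have hY0 : ∫⁻ z in Ω, ‖u z‖ₑ ^ p ≠ 0 := by
    rw [Ne, lintegral_eq_zero_iff' (hu.2.1.1.enorm.pow_const p)]
    refine fun h0 => hu0 ?_
    filter_upwards [h0] with z hz
    simpa [ENNReal.rpow_eq_zero_iff, hp0, hp0.not_gt] using hz
  have hYpos : 0 < ∫ z in Ω, ‖u z‖ ^ p := by
    rw [hpow hu.2.1] at hY0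
    simpa using hY0
  have hXnn : 0 ≤ ∫ z in Ω, ‖g z‖ ^ p := integral_nonneg fun z => by positivity
  have hm0 : 0 < m := by
    refine lt_of_le_of_ne ?_ hm.symm
    rw [heq] at hXnn
    exact nonneg_of_mul_nonneg_left hXnn hYpos
  refine ⟨hm0, sInf_le ⟨u, g, hu, hu0, hmean, ?_⟩⟩
  rw [hpow hu.2.1, hpow hu.2.2, heq, ENNReal.ofReal_mul hm0.le,
    ENNReal.mul_div_cancel_right (by simpa using hYpos) ENNReal.ofReal_ne_top]

/-! ### Choice of `q` and finiteness of the bound. -/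

/-- The exponents for which the bound is finite. -/
theorem exists_exponent {α a p : ℝ} (hα : 2 < α) (ha0 : 0 < a) (ha2 : a ≤ 2) (hp0 : 0 < p)
    (hp2 : p < 2) (h1 : (a + 2) / (a + 1) < p)
    (h2 : 2 - 2 * a / (2 + a) * ((α - 2) / α) < p) :
    ∃ q, 1 ≤ q ∧ q < 2 * p / (4 - p) ∧ (2 - p) * q / (p - q) < a ∧
      1 / q - 1 / 2 < 1 / (α * p / (α - 2)) := by
  have hα0 : 0 < α := by linarith
  have hα2 : 0 < α - 2 := by linarith
  set θ := (α - 2) / α with hθ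
  have hθ0 : 0 < θ := by positivity
  -- The root of `(2 - p) q / (p - q) = a`, so Brennan's range means `q < b`. The embedding
  -- condition reads `q > 2p/(p + 2θ)`. The hypotheses `h1` and `h2` say exactly that `b` exceeds
  -- `1` and this number.
  set b := a * p / (2 - p + a) with hb
  have hd : 0 < 2 - p + a := by linarith
  have hmax : max 1 (2 * p / (p + 2 * θ)) < b := by
    refine max_lt ?_ ?_
    · rw [div_lt_iff₀ (by linarith)] at h1
      rw [hb, lt_div_iff₀ hd]
      linarith
    · rw [hb, div_lt_div_iff₀ (by positivity) hd]
      have h3 : 2 * a / (2 + a) * θ * (2 + a) = 2 * a * θ := by field_simp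
      have h4 : (2 - p) * (2 + a) < 2 * a * θ := by
        rw [← h3]
        exact mul_lt_mul_of_pos_right (by linarith) (by linarith)
      nlinarith
  obtain ⟨q, hq1, hq2⟩ := exists_between hmax
  obtain ⟨hq1, hq3⟩ := max_lt_iff.1 hq1
  have hq0 : 0 < q := by linarith
  have hqb : q * (2 - p + a) < a * p := (lt_div_iff₀ hd).1 hq2
  have hqp : q < p := by nlinarith
  refine ⟨q, hq1.le, hq2.trans_le ?_, ?_, ?_⟩
  -- `b ≤ 2p/(4 - p)` is equivalent to `a ≤ 2`, with equality at `a = 2`.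
  · rw [hb, div_le_div_iff₀ hd (by linarith)]
    nlinarith [mul_nonneg hp0.le (mul_nonneg (sub_nonneg.2 ha2) (sub_nonneg.2 hp2.le))]
  · rw [div_lt_iff₀ (by linarith)]
    linarith
  · have h5 : 1 / (α * p / (α - 2)) = θ / p := by
      rw [hθ]
      field_simp
    rw [h5]
    rw [div_lt_iff₀ (by positivity)] at hq3
    rw [div_sub_div _ _ hq0.ne' two_ne_zero, div_lt_div_iff₀ (by positivity) hp0]
    nlinarith

theorem conformalBound_lt_top {α α₀ p : ℝ} {Ω : Set ℂ} {φ : ℂ → ℂ}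
    (hΩ : IsConformalRegular α Ω) (hφ : IsConformalOntoDisc Ω φ)
    (hα₀ : -2 ≤ α₀ ∧ α₀ < 0) (hB : BrennanConjectureOn (Ioo α₀ (2 / 3)))
    (hp : p ∈ Ioo (4 / 3 : ℝ) 2)
    (hlt : max ((|α₀| + 2) / (|α₀| + 1))
      (2 - 2 * |α₀| / (2 + |α₀|) * ((α - 2) / α)) < p) : conformalBound Ω φ α p < ⊤ := by
  have hA := discMoment_lt_top_of_isConformalRegular hΩ hφ
  have hα : 2 < α := hΩ.1
  have hp0 : 0 < p := by linarith [hp.1]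
  rw [abs_of_neg hα₀.2] at hlt
  obtain ⟨h1, h2⟩ := max_lt_iff.1 hlt
  obtain ⟨q, hq1, hq2, hq3, hq4⟩ := exists_exponent hα (neg_pos.2 hα₀.2) (by linarith [hα₀.1]) hp0
    hp.2 h1 h2
  have hq0 : 0 < q := by linarith
  have hqp : q < p := hq2.trans (two_mul_div_four_sub_lt hp0 hp.2)
  have hpq : 0 < p - q := sub_pos.2 hqp
  have hpr : p ≤ α * p / (α - 2) := by
    rw [le_div_iff₀ (by linarith)]
    nlinarith
  have hN : discMoment Ω φ ((p - 2) * q / (p - q)) < ⊤ := by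
    refine hB Ω φ hΩ.2.1 hφ _ ?_
    have h3 : (p - 2) * q / (p - q) = -((2 - p) * q / (p - q)) := by ring
    have h4 : 0 ≤ (2 - p) * q / (p - q) :=
      div_nonneg (mul_nonneg (by linarith [hp.2]) hq0.le) hpq.le
    rw [h3]
    constructor <;> linarith
  have hBfin : poincareSobolevConst unitDisc (α * p / (α - 2)) q < ⊤ :=
    poincareSobolevConst_unitDisc_lt_top hq1 (hqp.le.trans hpr) hq4
  refine (iInf₂_le q ⟨hq1, hq2⟩).trans_lt ?_
  refine ENNReal.mul_lt_top (ENNReal.mul_lt_top ?_ ?_) ?_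
  · rw [eLpNorm_ofReal_rpow (by linarith)]
    exact ENNReal.rpow_lt_top_of_nonneg (div_nonneg zero_le_two (by linarith)) hA.ne
  · exact ENNReal.rpow_lt_top_of_nonneg (by positivity) hN.ne
  · exact ENNReal.rpow_lt_top_of_nonneg hp0.le hBfin.ne

end

/-- At `α₀ = -2` the two thresholds are `4/3` and `(α + 2)/α`, which gives the case of the full
Brennan conjecture. A finite bound and the first conjunct yield positivity of the variational
eigenvalue. -/
theorem theoremA (α α₀ : ℝ) (Ω : Set ℂ) (φ : ℂ → ℂ)
    (hΩ : IsConformalRegular α Ω) (hφ : IsConformalOntoDisc Ω φ)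
    (hα₀ : -2 ≤ α₀ ∧ α₀ < 0) (hB : BrennanConjectureOn (Ioo α₀ (2 / 3))) :
    ∀ p ∈ Ioo (4 / 3 : ℝ) 2,
      (firstNeumannEigenvalue Ω p)⁻¹ ≤ conformalBound Ω φ α p ∧
      (∀ m : ℝ, m ≠ 0 → IsNeumannEigenvalue Ω p m →
        0 < m ∧ (ENNReal.ofReal m)⁻¹ ≤ conformalBound Ω φ α p) ∧
      (max ((|α₀| + 2) / (|α₀| + 1))
          (2 - 2 * |α₀| / (2 + |α₀|) * ((α - 2) / α)) < p →
        conformalBound Ω φ α p < ⊤) := by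
  intro p hp
  have h1 := inv_firstNeumannEigenvalue_le_conformalBound hΩ hφ hp
  refine ⟨h1, fun m hm hmev => ?_, fun hlt => conformalBound_lt_top hΩ hφ hα₀ hB hp hlt⟩
  have hvol := (hφ.isBiholomorphic hΩ.2.1).volume_lt_top hΩ.1
    (discMoment_lt_top_of_isConformalRegular hΩ hφ)
  obtain ⟨hm0, hle⟩ := hmev.firstNeumannEigenvalue_le hvol (by linarith [hp.1]) hm
  exact ⟨hm0, (ENNReal.inv_le_inv.2 hle).trans h1⟩
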